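/- Let $H=\mathbf 1_{[0,\infty)}$ be the Heaviside function on $\mathbb R$. For $u,v$ in the Schwartz space $\mathscr S(\mathbb R)$, let $$\mathcal W(u,v)(x,\xi)=\int_{\mathbb R}e^{-2i\pi z\xi}\,u\bigl(x+\tfrac z2\bigr)\,\overline{v\bigl(x-\tfrac z2\bigr)}\,dz\qquad((x,\xi)\in\mathbb R^2)$$ be their joint Wigner distribution. Let $A_0$ be the Weyl quantization of the indicator function $H(x)H(\xi)$ of the quarter-plane $\{x\ge 0,\ \xi\ge 0\}$, that is, the operator defined weakly on $\mathscr S(\mathbb R)$ by $$\langle A_0u,v\rangle=\iint_{\mathbb R^2}H(x)H(\xi)\,\mathcal W(u,v)(x,\xi)\,dx\,d\xi\qquad(u,v\in\mathscr S(\mathbb R)),$$ where $\langle\cdot,\cdot\rangle$ extends the scalar product of $L^2(\mathbb R)=L^2(\mathbb R;\mathbb C)$, linear in the first and antilinear in the second argument. The integrals converge absolutely, $A_0$ extends uniquely to a bounded operator on $L^2(\mathbb R)$, this extension is self-adjoint, and its spectrum satisfies $$\inf\bigl(\operatorname{spectrum}(A_0)\bigr)<0<1<\sup\bigl(\operatorname{spectrum}(A_0)\bigr).$$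 -/

import Mathlib

open MeasureTheory
open scoped SchwartzMap ComplexConjugate

/-- The Heaviside function `H`, the indicator function of `[0, ∞)`. -/
noncomputable def heavisideFn (x : ℝ) : ℝ := Set.indicator (Set.Ici (0 : ℝ)) (fun _ => 1) x

/-- The symbol `H(x) H(ξ)`, the indicator function of the quarter-plane, at `p = (x, ξ)`. -/
noncomputable def quarterPlaneSymbol (p : ℝ × ℝ) : ℂ :=
  ((heavisideFn p.1 * heavisideFn p.2 : ℝ) : ℂ)

/-- The joint Wigner function
`W(u,v)(x,ξ) = ∫ exp(-2iπ z ξ) u(x + z/2) conj (v(x - z/2)) dz`, at `p = (x, ξ)`. -/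
noncomputable def wignerFn (u v : ℝ → ℂ) (p : ℝ × ℝ) : ℂ :=
  ∫ z : ℝ, Complex.exp (-2 * Real.pi * Complex.I * z * p.2) *
    (u (p.1 + z / 2) * conj (v (p.1 - z / 2)))

/-- The bounded operator `A` on `L²(ℝ)` is (an extension of) the Weyl quantization of the function
`a` on phase space: for all Schwartz functions `u, v`, the product `a · W(u,v)` is integrable and
`⟨A u, v⟩ = ∬ a(x,ξ) W(u,v)(x,ξ) dx dξ`, the bracket being linear in `u` and antilinear in `v`.
(Mathlib's `inner` is antilinear in its first argument.) This is the weak form of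
`(A u)(x) = ∬ exp(2iπ (x-y) ξ) a((x+y)/2, ξ) u(y) dy dξ`. -/
def IsWeylQuantization (a : ℝ × ℝ → ℂ)
    (A : Lp ℂ 2 (volume : Measure ℝ) →L[ℂ] Lp ℂ 2 (volume : Measure ℝ)) : Prop :=
  ∀ u v : 𝓢(ℝ, ℂ),
    Integrable (fun p : ℝ × ℝ => a p * wignerFn u v p) volume ∧
    inner ℂ (v.toLp 2 volume) (A (u.toLp 2 volume)) = ∫ p : ℝ × ℝ, a p * wignerFn u v p

open FourierTransform in
/-- For a function in `L¹ ∩ L²`, the `L²` Fourier transform is given by the Fourier integral. -/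
theorem Lp.coeFn_fourier_of_integrable (f : Lp ℂ 2 (volume : Measure ℝ))
    (hf : Integrable f volume) :
    (𝓕 f : Lp ℂ 2 (volume : Measure ℝ)) =ᵐ[volume] 𝓕 (f : ℝ → ℂ) := by
  have hcont : Continuous (𝓕 (f : ℝ → ℂ)) :=
    VectorFourier.fourierIntegral_continuous Real.continuous_fourierChar
      (by exact continuous_inner) hf
  apply ae_eq_of_integral_contDiff_smul_eq
    ((Lp.memLp _).locallyIntegrable one_le_two) hcont.locallyIntegrable
  intro g hg hgs
  have hc : HasCompactSupport (Complex.ofRealCLM ∘ g) := hgs.comp_left rfl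
  have hd : ContDiff ℝ (↑(⊤ : ℕ∞)) (Complex.ofRealCLM ∘ g) := by fun_prop
  set G : 𝓢(ℝ, ℂ) := hc.toSchwartzMap hd
  have hG : ∀ x, G x = (g x : ℂ) := fun x => by simp [G]
  have h1 : ∫ x, G x • (𝓕 f : Lp ℂ 2 (volume : Measure ℝ)) x = ∫ x, (𝓕 G) x • f x := by
    rw [← Lp.toTemperedDistribution_apply, ← Lp.toTemperedDistribution_apply,
      ← Lp.fourier_toTemperedDistribution_eq, TemperedDistribution.fourier_apply]
  have h2 : ∫ x, (𝓕 (G : ℝ → ℂ)) x • f x = ∫ x, G x • 𝓕 (f : ℝ → ℂ) x := by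
    have := VectorFourier.integral_fourierIntegral_smul_eq_flip (μ := (volume : Measure ℝ))
      (ν := (volume : Measure ℝ)) (L := innerₗ ℝ) (f := G) (g := f)
      Real.continuous_fourierChar (by exact continuous_inner) G.integrable hf
    rw [flip_innerₗ] at this
    exact this
  rw [SchwartzMap.fourier_coe, h2] at h1
  simpa [hG] using h1

/-- Multiplication by the indicator function of `s`, as a bounded operator on `L²(ℝ)`. -/
noncomputable def Lp.indicatorCLM {s : Set ℝ} (hs : MeasurableSet s) :
    Lp ℂ 2 (volume : Measure ℝ) →L[ℂ] Lp ℂ 2 (volume : Measure ℝ) :=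
  LinearMap.mkContinuous
    { toFun := fun f => ((Lp.memLp f).indicator hs).toLp _
      map_add' := fun f g => by
        apply Lp.ext
        filter_upwards [((Lp.memLp (f + g)).indicator hs).coeFn_toLp,
          ((Lp.memLp f).indicator hs).coeFn_toLp, ((Lp.memLp g).indicator hs).coeFn_toLp,
          Lp.coeFn_add f g, Lp.coeFn_add (((Lp.memLp f).indicator hs).toLp _)
            (((Lp.memLp g).indicator hs).toLp _)] with x h1 h2 h3 h4 h5
        rw [h1, h5, Pi.add_apply, h2, h3]
        by_cases hx : x ∈ s
        · simp only [Set.indicator_of_mem hx]; exact h4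
        · simp [hx]
      map_smul' := fun c f => by
        apply Lp.ext
        filter_upwards [((Lp.memLp (c • f)).indicator hs).coeFn_toLp,
          ((Lp.memLp f).indicator hs).coeFn_toLp,
          Lp.coeFn_smul c f, Lp.coeFn_smul c (((Lp.memLp f).indicator hs).toLp _)]
          with x h1 h2 h4 h5
        rw [h1, RingHom.id_apply, h5, Pi.smul_apply, h2]
        by_cases hx : x ∈ s
        · simp only [Set.indicator_of_mem hx]; exact h4
        · simp [hx] }
    1 (fun f => by
      rw [one_mul]
      apply Lp.norm_le_norm_of_ae_le
      filter_upwards [((Lp.memLp f).indicator hs).coeFn_toLp] with x h1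
      simp only [LinearMap.coe_mk, AddHom.coe_mk]
      rw [h1]
      exact norm_indicator_le_norm_self _ _)

theorem Lp.indicatorCLM_coeFn {s : Set ℝ} (hs : MeasurableSet s)
    (f : Lp ℂ 2 (volume : Measure ℝ)) :
    Lp.indicatorCLM hs f =ᵐ[volume] s.indicator f :=
  ((Lp.memLp f).indicator hs).coeFn_toLp

/-- The operator `1_{ξ ≥ 0} F 1_{x ≥ 0}` on `L²(ℝ)`, `F` being the Fourier transform. -/
noncomputable def halfLineFourier :
    Lp ℂ 2 (volume : Measure ℝ) →L[ℂ] Lp ℂ 2 (volume : Measure ℝ) :=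
  Lp.indicatorCLM (measurableSet_Ici (a := (0 : ℝ))) ∘L
    (Lp.fourierTransformₗᵢ ℝ ℂ : Lp ℂ 2 (volume : Measure ℝ) →L[ℂ] Lp ℂ 2 volume) ∘L
    Lp.indicatorCLM (measurableSet_Ici (a := (0 : ℝ)))

open FourierTransform in
theorem halfLineFourier_coeFn (u : Lp ℂ 2 (volume : Measure ℝ)) {f : ℝ → ℂ}
    (huf : (Set.Ici (0 : ℝ)).indicator u =ᵐ[volume] f) (hf : Integrable f volume) :
    halfLineFourier u =ᵐ[volume] (Set.Ici (0 : ℝ)).indicator (𝓕 f) := by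
  have h0 : Lp.indicatorCLM (measurableSet_Ici (a := (0 : ℝ))) u =ᵐ[volume] f :=
    (Lp.indicatorCLM_coeFn _ u).trans huf
  have h1 := Lp.coeFn_fourier_of_integrable
    (Lp.indicatorCLM (measurableSet_Ici (a := (0 : ℝ))) u) (hf.congr h0.symm)
  have h2 : 𝓕 (Lp.indicatorCLM (measurableSet_Ici (a := (0 : ℝ))) u : ℝ → ℂ) = 𝓕 f := by
    ext ξ
    rw [Real.fourier_eq, Real.fourier_eq]
    exact integral_congr_ae (h0.mono fun x hx => by simp only [hx])
  rw [h2] at h1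
  refine (Lp.indicatorCLM_coeFn measurableSet_Ici _).trans ?_
  filter_upwards [h1] with x hx
  by_cases hx0 : x ∈ Set.Ici (0 : ℝ)
  · simp only [Set.indicator_of_mem hx0]; exact hx
  · simp [hx0]

open FourierTransform in
theorem inner_halfLineFourier (u v : Lp ℂ 2 (volume : Measure ℝ)) {f g : ℝ → ℂ}
    (huf : (Set.Ici (0 : ℝ)).indicator u =ᵐ[volume] f) (hf : Integrable f volume)
    (hvg : (Set.Ici (0 : ℝ)).indicator v =ᵐ[volume] g) (hg : Integrable g volume) :
    IntegrableOn (fun ξ => 𝓕 f ξ * conj (𝓕 g ξ)) (Set.Ici (0 : ℝ)) ∧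
    inner ℂ (halfLineFourier v) (halfLineFourier u) =
      ∫ ξ in Set.Ici (0 : ℝ), 𝓕 f ξ * conj (𝓕 g ξ) := by
  have key : (fun ξ => inner ℂ (halfLineFourier v ξ) (halfLineFourier u ξ)) =ᵐ[volume]
      (Set.Ici (0 : ℝ)).indicator (fun ξ => 𝓕 f ξ * conj (𝓕 g ξ)) := by
    filter_upwards [halfLineFourier_coeFn u huf hf, halfLineFourier_coeFn v hvg hg] with x h1 h2
    rw [h1, h2]
    by_cases hx0 : x ∈ Set.Ici (0 : ℝ)
    · simp [Set.indicator_of_mem hx0]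
    · simp [hx0]
  constructor
  · rw [← integrable_indicator_iff measurableSet_Ici]
    exact (L2.integrable_inner _ _).congr key
  · rw [L2.inner_def, integral_congr_ae key, integral_indicator measurableSet_Ici]

theorem Lp.norm_sq_eq_integral (w : Lp ℂ 2 (volume : Measure ℝ)) :
    ‖w‖ ^ 2 = ∫ x, ‖w x‖ ^ 2 := by
  have h := L2.inner_def (𝕜 := ℂ) w w
  simp only [inner_self_eq_norm_sq_to_K] at h
  rw [← RCLike.ofReal_pow] at h
  simp only [← RCLike.ofReal_pow] at h
  rw [integral_ofReal] at h
  exact_mod_cast h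

open FourierTransform in
theorem norm_sq_sub_inner_halfLineFourier (u : Lp ℂ 2 (volume : Measure ℝ)) {f : ℝ → ℂ}
    (huf : u =ᵐ[volume] f) (hf : Integrable f volume) (hf0 : ∀ x < 0, f x = 0) :
    IntegrableOn (fun ξ => ‖𝓕 f ξ‖ ^ 2) (Set.Iio (0 : ℝ)) ∧
    ‖u‖ ^ 2 = (∫ ξ in Set.Iio (0 : ℝ), ‖𝓕 f ξ‖ ^ 2) + ‖halfLineFourier u‖ ^ 2 ∧
    IntegrableOn (fun ξ => ‖𝓕 f ξ‖ ^ 2) (Set.Ici (0 : ℝ)) ∧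
    ‖halfLineFourier u‖ ^ 2 = ∫ ξ in Set.Ici (0 : ℝ), ‖𝓕 f ξ‖ ^ 2 := by
  have hu0 : (Set.Ici (0 : ℝ)).indicator u =ᵐ[volume] f := by
    filter_upwards [huf] with x hx
    by_cases hx0 : x ∈ Set.Ici (0 : ℝ)
    · rw [Set.indicator_of_mem hx0, hx]
    · rw [Set.indicator_of_notMem hx0, hf0 x (by simpa using hx0)]
  have h1 := Lp.coeFn_fourier_of_integrable u (hf.congr huf.symm)
  have h2 : 𝓕 (u : ℝ → ℂ) = 𝓕 f := by
    ext ξ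
    rw [Real.fourier_eq, Real.fourier_eq]
    exact integral_congr_ae (huf.mono fun x hx => by simp only [hx])
  rw [h2] at h1
  have h3 : ‖u‖ ^ 2 = ∫ ξ, ‖𝓕 f ξ‖ ^ 2 := by
    rw [← Lp.norm_fourier_eq u, Lp.norm_sq_eq_integral]
    exact integral_congr_ae (h1.mono fun x hx => by simp only [hx])
  have h4 : Integrable (fun ξ => ‖𝓕 f ξ‖ ^ 2) :=
    ((Lp.memLp (𝓕 u)).integrable_norm_pow two_ne_zero).congr
      (h1.mono fun x hx => by simp only [hx])
  have h5 : ‖halfLineFourier u‖ ^ 2 = ∫ ξ in Set.Ici (0 : ℝ), ‖𝓕 f ξ‖ ^ 2 := by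
    rw [Lp.norm_sq_eq_integral, ← integral_indicator measurableSet_Ici]
    refine integral_congr_ae ((halfLineFourier_coeFn u hu0 hf).mono fun x hx => ?_)
    simp only [hx]
    by_cases hx0 : x ∈ Set.Ici (0 : ℝ)
    · simp only [Set.indicator_of_mem hx0]
    · simp [hx0]
  refine ⟨h4.integrableOn, ?_, h4.integrableOn, h5⟩
  rw [h5, h3, ← Set.compl_Iio]
  exact (integral_add_compl measurableSet_Iio h4).symm

theorem SchwartzMap.norm_le_div_one_add_sq_sq (u : 𝓢(ℝ, ℂ)) :
    ∃ C, 0 < C ∧ ∀ x, ‖u x‖ ≤ C / (1 + x ^ 2) ^ 2 := by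
  obtain ⟨A, hA, h0⟩ := u.decay 0 0
  obtain ⟨B, hB, h4⟩ := u.decay 4 0
  refine ⟨2 * (A + B), by positivity, fun x => ?_⟩
  have h0 := h0 x
  have h4 := h4 x
  simp only [norm_iteratedFDeriv_zero, pow_zero, one_mul, Real.norm_eq_abs] at h0 h4
  have hx : |x| ^ 4 = x ^ 4 := by rw [show 4 = 2 * 2 from rfl, pow_mul, pow_mul, sq_abs]
  rw [hx] at h4
  rw [le_div_iff₀ (by positivity)]
  have : (1 + x ^ 2) ^ 2 ≤ 2 * (1 + x ^ 4) := by nlinarith [sq_nonneg (x ^ 2 - 1)]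
  calc ‖u x‖ * (1 + x ^ 2) ^ 2 ≤ ‖u x‖ * (2 * (1 + x ^ 4)) := by gcongr
    _ = 2 * (‖u x‖ + x ^ 4 * ‖u x‖) := by ring
    _ ≤ 2 * (A + B) := by gcongr

/-- The integrand `u(x + z/2) conj(v(x - z/2))` of the Wigner function, at `p = (x, z)`. -/
noncomputable def wignerKernel (u v : ℝ → ℂ) (p : ℝ × ℝ) : ℂ :=
  u (p.1 + p.2 / 2) * conj (v (p.1 - p.2 / 2))

theorem norm_wignerKernel_le (u v : 𝓢(ℝ, ℂ)) :
    ∃ C, 0 < C ∧ ∀ p : ℝ × ℝ,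
      ‖wignerKernel u v p‖ ≤ C * ((1 + p.1 ^ 2)⁻¹ * (1 + p.2 ^ 2)⁻¹) := by
  obtain ⟨A, hA, hu⟩ := u.norm_le_div_one_add_sq_sq
  obtain ⟨B, hB, hv⟩ := v.norm_le_div_one_add_sq_sq
  refine ⟨2 * (A * B), by positivity, fun p => ?_⟩
  rw [wignerKernel, norm_mul, RCLike.norm_conj]
  set s := p.1 + p.2 / 2 with hs
  set t := p.1 - p.2 / 2 with ht
  have h1 : s ^ 2 + t ^ 2 = 2 * p.1 ^ 2 + p.2 ^ 2 / 2 := by rw [hs, ht]; ring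
  have h2 : 1 + 2 * p.1 ^ 2 + p.2 ^ 2 / 2 ≤ (1 + s ^ 2) * (1 + t ^ 2) := by
    nlinarith [mul_nonneg (sq_nonneg s) (sq_nonneg t)]
  have h3 : (1 + p.1 ^ 2) * (1 + p.2 ^ 2) ≤ 2 * ((1 + s ^ 2) ^ 2 * (1 + t ^ 2) ^ 2) := by
    rw [← mul_pow]
    calc (1 + p.1 ^ 2) * (1 + p.2 ^ 2)
        ≤ (1 + 2 * p.1 ^ 2 + p.2 ^ 2 / 2) * (2 * (1 + 2 * p.1 ^ 2 + p.2 ^ 2 / 2)) := by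
          apply mul_le_mul _ _ (by positivity) (by positivity) <;>
            nlinarith [sq_nonneg p.1, sq_nonneg p.2]
      _ ≤ ((1 + s ^ 2) * (1 + t ^ 2)) * (2 * ((1 + s ^ 2) * (1 + t ^ 2))) := by gcongr
      _ = _ := by ring
  calc ‖u s‖ * ‖v t‖ ≤ A / (1 + s ^ 2) ^ 2 * (B / (1 + t ^ 2) ^ 2) := by
        gcongr
        · exact hu s
        · exact hv t
    _ = A * B / ((1 + s ^ 2) ^ 2 * (1 + t ^ 2) ^ 2) := div_mul_div_comm _ _ _ _
    _ ≤ A * B / ((1 + p.1 ^ 2) * (1 + p.2 ^ 2) / 2) := by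
        apply div_le_div_of_nonneg_left (by positivity) (by positivity)
        linarith
    _ = _ := by
      have : 0 < 1 + p.1 ^ 2 := by positivity
      have : 0 < 1 + p.2 ^ 2 := by positivity
      field_simp

theorem continuous_wignerKernel (u v : 𝓢(ℝ, ℂ)) : Continuous (wignerKernel u v) := by
  unfold wignerKernel
  have := u.continuous
  have := v.continuous
  fun_prop

theorem integrable_wignerKernel (u v : 𝓢(ℝ, ℂ)) :
    Integrable (wignerKernel u v) (volume : Measure (ℝ × ℝ)) := by
  obtain ⟨C, hC, h⟩ := norm_wignerKernel_le u v
  refine Integrable.mono'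
    ((integrable_inv_one_add_sq.mul_prod integrable_inv_one_add_sq).const_mul C)
    (continuous_wignerKernel u v).aestronglyMeasurable (Filter.Eventually.of_forall h)

theorem integrable_wignerKernel_right (u v : 𝓢(ℝ, ℂ)) (x : ℝ) :
    Integrable (fun z => wignerKernel u v (x, z)) := by
  obtain ⟨C, hC, h⟩ := norm_wignerKernel_le u v
  refine Integrable.mono' ((integrable_inv_one_add_sq.const_mul (1 + x ^ 2)⁻¹).const_mul C)
    ((continuous_wignerKernel u v).comp (by fun_prop)).aestronglyMeasurable
    (Filter.Eventually.of_forall fun z => h (x, z))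

theorem norm_exp_two_pi (z ξ : ℝ) : ‖Complex.exp (-2 * Real.pi * Complex.I * z * ξ)‖ = 1 := by
  rw [Complex.norm_exp]
  simp

theorem wignerFn_eq (u v : ℝ → ℂ) (p : ℝ × ℝ) :
    wignerFn u v p =
      ∫ z : ℝ, Complex.exp (-2 * Real.pi * Complex.I * z * p.2) * wignerKernel u v (p.1, z) :=
  rfl

theorem integrable_exp_mul_wignerKernel_right (u v : 𝓢(ℝ, ℂ)) (x ξ : ℝ) :
    Integrable (fun z : ℝ =>
      Complex.exp (-2 * Real.pi * Complex.I * z * ξ) * wignerKernel u v (x, z)) := by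
  refine (integrable_wignerKernel_right u v x).bdd_mul (c := 1)
    (Continuous.aestronglyMeasurable (by fun_prop))
    (Filter.Eventually.of_forall fun z => (norm_exp_two_pi z ξ).le)

theorem norm_wignerFn_le (u v : 𝓢(ℝ, ℂ)) :
    ∃ C, 0 < C ∧ ∀ p : ℝ × ℝ, ‖wignerFn u v p‖ ≤ C * (1 + p.1 ^ 2)⁻¹ := by
  obtain ⟨C, hC, h⟩ := norm_wignerKernel_le u v
  refine ⟨C * Real.pi, by positivity, fun p => ?_⟩
  rw [wignerFn_eq]
  calc _ ≤ ∫ z : ℝ, C * ((1 + p.1 ^ 2)⁻¹ * (1 + z ^ 2)⁻¹) := by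
        refine norm_integral_le_of_norm_le
          ((integrable_inv_one_add_sq.const_mul (1 + p.1 ^ 2)⁻¹).const_mul C)
          (Filter.Eventually.of_forall fun z => ?_)
        rw [norm_mul, norm_exp_two_pi, one_mul]
        exact h (p.1, z)
    _ = _ := by
        rw [integral_const_mul, integral_const_mul, integral_univ_inv_one_add_sq]
        ring

theorem hasDerivAt_wignerKernel (u v : 𝓢(ℝ, ℂ)) (x z : ℝ) :
    HasDerivAt (fun z => wignerKernel u v (x, z))
      ((wignerKernel (SchwartzMap.derivCLM ℂ ℂ u) v (x, z) -
        wignerKernel u (SchwartzMap.derivCLM ℂ ℂ v) (x, z)) / 2) z := by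
  have hu := (u.differentiable.differentiableAt (x := x + z / 2)).hasDerivAt
  have hv := (v.differentiable.differentiableAt (x := x - z / 2)).hasDerivAt
  have h1 : HasDerivAt (fun z : ℝ => x + z / 2) (1 / 2) z :=
    ((hasDerivAt_id z).div_const 2).const_add x
  have h2 : HasDerivAt (fun z : ℝ => x - z / 2) (-(1 / 2)) z :=
    ((hasDerivAt_id z).div_const 2).const_sub x
  have h := (hu.scomp z h1).mul (hv.scomp z h2).star
  convert! h using 1
  simp [wignerKernel, SchwartzMap.derivCLM_apply]
  ring

theorem mul_wignerFn (u v : 𝓢(ℝ, ℂ)) (p : ℝ × ℝ) :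
    4 * Real.pi * Complex.I * p.2 * wignerFn u v p =
      wignerFn (SchwartzMap.derivCLM ℂ ℂ u) v p - wignerFn u (SchwartzMap.derivCLM ℂ ℂ v) p := by
  obtain ⟨x, ξ⟩ := p
  have hE : ∀ z : ℝ, HasDerivAt (fun z : ℝ => Complex.exp (-2 * Real.pi * Complex.I * z * ξ))
      (Complex.exp (-2 * Real.pi * Complex.I * z * ξ) * (-2 * Real.pi * Complex.I * ξ)) z := by
    intro z
    have h0 : HasDerivAt (fun z : ℝ => (z : ℂ)) 1 z := Complex.ofRealCLM.hasDerivAt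
    have := ((h0.const_mul (-2 * Real.pi * Complex.I)).mul_const (ξ : ℂ)).cexp
    simpa using this
  have hi1 := integrable_exp_mul_wignerKernel_right u v x ξ
  have hi2 := integrable_exp_mul_wignerKernel_right (SchwartzMap.derivCLM ℂ ℂ u) v x ξ
  have hi3 := integrable_exp_mul_wignerKernel_right u (SchwartzMap.derivCLM ℂ ℂ v) x ξ
  have hd := fun z => (hE z).mul (hasDerivAt_wignerKernel u v x z)
  have hi4 := (hi1.const_mul (-2 * Real.pi * Complex.I * ξ)).add ((hi2.sub hi3).div_const 2)
  have hint := integral_eq_zero_of_hasDerivAt_of_integrable hd (hi4.congr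
    (Filter.Eventually.of_forall fun z => by simp only [Pi.add_apply, Pi.sub_apply]; ring)) hi1
  have h5 : ∫ z : ℝ, ((-2 * Real.pi * Complex.I * ξ) *
      (Complex.exp (-2 * Real.pi * Complex.I * z * ξ) * wignerKernel u v (x, z)) +
      (Complex.exp (-2 * Real.pi * Complex.I * z * ξ) *
          wignerKernel (SchwartzMap.derivCLM ℂ ℂ u) v (x, z) -
        Complex.exp (-2 * Real.pi * Complex.I * z * ξ) *
          wignerKernel u (SchwartzMap.derivCLM ℂ ℂ v) (x, z)) / 2) = 0 := by
    rw [← hint]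
    congr 1
    ext z
    ring
  have hi5 : Integrable (fun z : ℝ => (Complex.exp (-2 * Real.pi * Complex.I * z * ξ) *
          wignerKernel (SchwartzMap.derivCLM ℂ ℂ u) v (x, z) -
        Complex.exp (-2 * Real.pi * Complex.I * z * ξ) *
          wignerKernel u (SchwartzMap.derivCLM ℂ ℂ v) (x, z)) / 2) := (hi2.sub hi3).div_const 2
  rw [integral_add (hi1.const_mul _) hi5, integral_const_mul,
    integral_div, integral_sub hi2 hi3] at h5
  simp only [wignerFn_eq]
  linear_combination -2 * h5

theorem aestronglyMeasurable_wignerFn (u v : 𝓢(ℝ, ℂ)) :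
    AEStronglyMeasurable (wignerFn u v) (volume : Measure (ℝ × ℝ)) := by
  have h : Continuous (fun q : (ℝ × ℝ) × ℝ =>
      Complex.exp (-2 * Real.pi * Complex.I * q.2 * q.1.2) * wignerKernel u v (q.1.1, q.2)) := by
    have := continuous_wignerKernel u v
    fun_prop
  exact h.aestronglyMeasurable.integral_prod_right' (μ := (volume : Measure (ℝ × ℝ)))
    (ν := (volume : Measure ℝ))

/-- The Wigner function of two Schwartz functions is integrable on phase space. -/
theorem integrable_wignerFn (u v : 𝓢(ℝ, ℂ)) :
    Integrable (wignerFn u v) (volume : Measure (ℝ × ℝ)) := by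
  set D := SchwartzMap.derivCLM ℂ ℂ
  obtain ⟨C0, hC0, h0⟩ := norm_wignerFn_le u v
  obtain ⟨C1, hC1, h1⟩ := norm_wignerFn_le (D (D u)) v
  obtain ⟨C2, hC2, h2⟩ := norm_wignerFn_le (D u) (D v)
  obtain ⟨C3, hC3, h3⟩ := norm_wignerFn_le u (D (D v))
  refine Integrable.mono'
    ((integrable_inv_one_add_sq.mul_prod integrable_inv_one_add_sq).const_mul
      (C0 + C1 + C2 * 2 + C3)) (aestronglyMeasurable_wignerFn u v)
    (Filter.Eventually.of_forall fun p => ?_)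
  have e1 : (4 * Real.pi * Complex.I * p.2) ^ 2 * wignerFn u v p =
      wignerFn (D (D u)) v p - 2 * wignerFn (D u) (D v) p + wignerFn u (D (D v)) p := by
    have a1 := mul_wignerFn u v p
    have a2 := mul_wignerFn (D u) v p
    have a3 := mul_wignerFn u (D v) p
    linear_combination (4 * Real.pi * Complex.I * p.2) * a1 + a2 - a3
  have e2 : (4 * Real.pi * p.2) ^ 2 * ‖wignerFn u v p‖ ≤
      C1 * (1 + p.1 ^ 2)⁻¹ + 2 * (C2 * (1 + p.1 ^ 2)⁻¹) + C3 * (1 + p.1 ^ 2)⁻¹ := by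
    have : (4 * Real.pi * p.2) ^ 2 * ‖wignerFn u v p‖ =
        ‖(4 * Real.pi * Complex.I * p.2) ^ 2 * wignerFn u v p‖ := by
      rw [norm_mul, norm_pow]
      congr 1
      simp [mul_pow]
    rw [this, e1]
    refine (norm_add_le _ _).trans (add_le_add ((norm_sub_le _ _).trans
      (add_le_add (h1 p) ?_)) (h3 p))
    rw [norm_mul, Complex.norm_ofNat]
    gcongr
    exact h2 p
  have e3 : (1 + p.2 ^ 2) * ‖wignerFn u v p‖ ≤ (C0 + C1 + C2 * 2 + C3) * (1 + p.1 ^ 2)⁻¹ := by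
    have hpi : p.2 ^ 2 ≤ (4 * Real.pi * p.2) ^ 2 := by
      rw [mul_pow]
      have := Real.pi_gt_three
      exact le_mul_of_one_le_left (sq_nonneg _) (by nlinarith)
    have := mul_le_mul_of_nonneg_right hpi (norm_nonneg (wignerFn u v p))
    linarith [h0 p]
  have hp : 0 < 1 + p.2 ^ 2 := by positivity
  rw [← mul_assoc, ← div_eq_mul_inv, le_div_iff₀ hp]
  linarith

theorem integrableOn_sqrt_weight_div_max {a : ℝ} (ha : 0 < a) :
    IntegrableOn (fun y : ℝ => a ^ (1 / 2 : ℝ) * y ^ (-1 / 2 : ℝ) * (max a y)⁻¹) (Set.Ioi 0) ∧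
    ∫ y in Set.Ioi 0, a ^ (1 / 2 : ℝ) * y ^ (-1 / 2 : ℝ) * (max a y)⁻¹ = 4 := by
  have e1 : Set.EqOn (fun y : ℝ => a ^ (1 / 2 : ℝ) * y ^ (-1 / 2 : ℝ) * (max a y)⁻¹)
      (fun y => (a ^ (1 / 2 : ℝ) * a⁻¹) * y ^ (-1 / 2 : ℝ)) (Set.Ioc 0 a) := by
    intro y hy
    simp only
    rw [max_eq_left hy.2]
    ring
  have e2 : Set.EqOn (fun y : ℝ => a ^ (1 / 2 : ℝ) * y ^ (-1 / 2 : ℝ) * (max a y)⁻¹)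
      (fun y => a ^ (1 / 2 : ℝ) * y ^ (-3 / 2 : ℝ)) (Set.Ioi a) := by
    intro y hy
    have hy0 : 0 < y := ha.trans hy
    simp only
    rw [max_eq_right (le_of_lt hy), mul_assoc, ← Real.rpow_neg_one y, ← Real.rpow_add hy0]
    norm_num
  have i1 : IntegrableOn (fun y : ℝ => a ^ (1 / 2 : ℝ) * y ^ (-1 / 2 : ℝ) * (max a y)⁻¹)
      (Set.Ioc 0 a) := by
    refine IntegrableOn.congr_fun ?_ e1.symm measurableSet_Ioc
    refine Integrable.const_mul ?_ _
    exact (intervalIntegrable_iff_integrableOn_Ioc_of_le ha.le).1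
      (intervalIntegral.intervalIntegrable_rpow' (by norm_num))
  have i2 : IntegrableOn (fun y : ℝ => a ^ (1 / 2 : ℝ) * y ^ (-1 / 2 : ℝ) * (max a y)⁻¹)
      (Set.Ioi a) := by
    refine IntegrableOn.congr_fun ?_ e2.symm measurableSet_Ioi
    exact Integrable.const_mul (integrableOn_Ioi_rpow_of_lt (by norm_num) ha) _
  have hu : Set.Ioc 0 a ∪ Set.Ioi a = Set.Ioi 0 := Set.Ioc_union_Ioi_eq_Ioi ha.le
  refine ⟨hu ▸ i1.union i2, ?_⟩
  rw [← hu, setIntegral_union Set.Ioc_disjoint_Ioi_same measurableSet_Ioi i1 i2,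
    setIntegral_congr_fun measurableSet_Ioc e1, setIntegral_congr_fun measurableSet_Ioi e2,
    integral_const_mul, integral_const_mul, integral_Ioi_rpow_of_lt (by norm_num) ha,
    ← intervalIntegral.integral_of_le ha.le, integral_rpow (Or.inl (by norm_num))]
  norm_num
  have h1 : a ^ (1 / 2 : ℝ) * a ^ (1 / 2 : ℝ) = a := by
    rw [← Real.rpow_add ha]; norm_num
  have h2 : a ^ (1 / 2 : ℝ) * a ^ (-1 / 2 : ℝ) = 1 := by
    rw [← Real.rpow_add ha]; norm_num
  norm_num at h1 h2 ⊢
  field_simp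
  nlinarith

theorem integrable_sqrt_weight_div_max {s : ℝ} (hs : s ≠ 0) :
    Integrable (fun t : ℝ => |s| ^ (1 / 2 : ℝ) * |t| ^ (-1 / 2 : ℝ) * (max |s| |t|)⁻¹) ∧
    ∫ t : ℝ, |s| ^ (1 / 2 : ℝ) * |t| ^ (-1 / 2 : ℝ) * (max |s| |t|)⁻¹ = 8 := by
  have h : ∫ t : ℝ, |s| ^ (1 / 2 : ℝ) * |t| ^ (-1 / 2 : ℝ) * (max |s| |t|)⁻¹ = 8 := by
    rw [integral_comp_abs (f := fun y => |s| ^ (1 / 2 : ℝ) * y ^ (-1 / 2 : ℝ) * (max |s| y)⁻¹),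
      (integrableOn_sqrt_weight_div_max (abs_pos.2 hs)).2]
    norm_num
  refine ⟨?_, h⟩
  by_contra hn
  rw [integral_undef hn] at h
  norm_num at h

theorem integrable_schur_majorant {φ : ℝ → ℝ} (hφ : Integrable φ volume) (h0 : ∀ s, 0 ≤ φ s) :
    Integrable (fun p : ℝ × ℝ =>
      (|p.1| ^ (1 / 2 : ℝ) * |p.2| ^ (-1 / 2 : ℝ) * (max |p.1| |p.2|)⁻¹) * φ p.1) volume ∧
    ∫ p : ℝ × ℝ, (|p.1| ^ (1 / 2 : ℝ) * |p.2| ^ (-1 / 2 : ℝ) * (max |p.1| |p.2|)⁻¹) * φ p.1 =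
      8 * ∫ s, φ s := by
  have hne : ∀ᵐ s : ℝ, s ≠ 0 := by simp [ae_iff]
  have hm : AEStronglyMeasurable (fun p : ℝ × ℝ =>
      (|p.1| ^ (1 / 2 : ℝ) * |p.2| ^ (-1 / 2 : ℝ) * (max |p.1| |p.2|)⁻¹) * φ p.1)
      ((volume : Measure ℝ).prod volume) := by
    refine AEStronglyMeasurable.mul (Measurable.aestronglyMeasurable (by fun_prop)) ?_
    exact hφ.1.comp_fst
  have hi : Integrable (fun p : ℝ × ℝ =>
      (|p.1| ^ (1 / 2 : ℝ) * |p.2| ^ (-1 / 2 : ℝ) * (max |p.1| |p.2|)⁻¹) * φ p.1)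
      ((volume : Measure ℝ).prod volume) := by
    rw [integrable_prod_iff hm]
    constructor
    · filter_upwards [hne] with s hs
      exact (integrable_sqrt_weight_div_max hs).1.mul_const _
    · refine (hφ.const_mul 8).congr ?_
      filter_upwards [hne] with s hs
      rw [← (integrable_sqrt_weight_div_max hs).2, ← integral_mul_const]
      congr 1
      ext t
      rw [Real.norm_of_nonneg]
      have := h0 s
      positivity
  refine ⟨hi, ?_⟩
  rw [Measure.volume_eq_prod, integral_prod _ hi, ← integral_const_mul]
  refine integral_congr_ae ?_
  filter_upwards [hne] with s hs
  rw [integral_mul_const, (integrable_sqrt_weight_div_max hs).2]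

/-- A form of Schur's test for the kernel `1 / max(|s|, |t|)`. -/
theorem integrable_kernel_mul {K : ℝ × ℝ → ℂ} (hK : Measurable K)
    (hKb : ∀ p, ‖K p‖ ≤ (max |p.1| |p.2|)⁻¹) {u v : ℝ → ℂ}
    (hu : MemLp u 2 volume) (hv : MemLp v 2 volume) :
    Integrable (fun p : ℝ × ℝ => K p * (u p.1 * conj (v p.2))) volume ∧
    ‖∫ p : ℝ × ℝ, K p * (u p.1 * conj (v p.2))‖ ≤
      4 * (∫ s, ‖u s‖ ^ 2) + 4 * ∫ t, ‖v t‖ ^ 2 := by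
  obtain ⟨a1, a2⟩ := integrable_schur_majorant (hu.integrable_norm_pow two_ne_zero)
    fun s => by positivity
  obtain ⟨b1, b2⟩ := integrable_schur_majorant (hv.integrable_norm_pow two_ne_zero)
    fun s => by positivity
  have b3 := b1.swap
  have b4 := integral_prod_swap (μ := (volume : Measure ℝ)) (ν := (volume : Measure ℝ))
    (fun p : ℝ × ℝ =>
      (|p.1| ^ (1 / 2 : ℝ) * |p.2| ^ (-1 / 2 : ℝ) * (max |p.1| |p.2|)⁻¹) * ‖v p.1‖ ^ 2)
  rw [← Measure.volume_eq_prod, b2] at b4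
  have hne1 : ∀ᵐ p : ℝ × ℝ, p.1 ≠ 0 :=
    Measure.quasiMeasurePreserving_fst.ae (p := fun s : ℝ => s ≠ 0) (by simp [ae_iff])
  have hne2 : ∀ᵐ p : ℝ × ℝ, p.2 ≠ 0 :=
    Measure.quasiMeasurePreserving_snd.ae (p := fun s : ℝ => s ≠ 0) (by simp [ae_iff])
  have hle : ∀ᵐ p : ℝ × ℝ, ‖K p * (u p.1 * conj (v p.2))‖ ≤ (1 / 2) *
      ((|p.1| ^ (1 / 2 : ℝ) * |p.2| ^ (-1 / 2 : ℝ) * (max |p.1| |p.2|)⁻¹) * ‖u p.1‖ ^ 2) +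
      (1 / 2) * ((|p.2| ^ (1 / 2 : ℝ) * |p.1| ^ (-1 / 2 : ℝ) * (max |p.2| |p.1|)⁻¹) *
        ‖v p.2‖ ^ 2) := by
    filter_upwards [hne1, hne2] with p h1 h2
    rw [norm_mul, norm_mul, RCLike.norm_conj]
    refine (mul_le_mul_of_nonneg_right (hKb p) (by positivity)).trans ?_
    rw [max_comm |p.2|]
    have hs := abs_pos.2 h1
    have ht := abs_pos.2 h2
    set m := (max |p.1| |p.2|)⁻¹
    have hm : 0 ≤ m := by positivity
    set a := |p.1| ^ (1 / 2 : ℝ) * |p.2| ^ (-1 / 2 : ℝ)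
    set b := |p.2| ^ (1 / 2 : ℝ) * |p.1| ^ (-1 / 2 : ℝ)
    have ha : 0 ≤ a := by positivity
    have hb : 0 ≤ b := by positivity
    have hab : a * b = 1 := by
      have e1 : |p.1| ^ (1 / 2 : ℝ) * |p.1| ^ (-1 / 2 : ℝ) = 1 := by
        rw [← Real.rpow_add hs]; norm_num
      have e2 : |p.2| ^ (1 / 2 : ℝ) * |p.2| ^ (-1 / 2 : ℝ) = 1 := by
        rw [← Real.rpow_add ht]; norm_num
      calc a * b = (|p.1| ^ (1 / 2 : ℝ) * |p.1| ^ (-1 / 2 : ℝ)) *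
            (|p.2| ^ (1 / 2 : ℝ) * |p.2| ^ (-1 / 2 : ℝ)) := by simp only [a, b]; ring
        _ = 1 := by rw [e1, e2, one_mul]
    have key : ‖u p.1‖ * ‖v p.2‖ ≤ 1 / 2 * (a * ‖u p.1‖ ^ 2) + 1 / 2 * (b * ‖v p.2‖ ^ 2) := by
      have e3 := Real.sq_sqrt ha
      have e4 := Real.sq_sqrt hb
      have e5 : √a * √b = 1 := by rw [← Real.sqrt_mul ha, hab, Real.sqrt_one]
      have : (√a * ‖u p.1‖ - √b * ‖v p.2‖) ^ 2 =
          a * ‖u p.1‖ ^ 2 - 2 * (‖u p.1‖ * ‖v p.2‖) + b * ‖v p.2‖ ^ 2 := by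
        linear_combination ‖u p.1‖ ^ 2 * e3 + ‖v p.2‖ ^ 2 * e4 - 2 * ‖u p.1‖ * ‖v p.2‖ * e5
      nlinarith [sq_nonneg (√a * ‖u p.1‖ - √b * ‖v p.2‖)]
    calc m * (‖u p.1‖ * ‖v p.2‖)
        ≤ m * (1 / 2 * (a * ‖u p.1‖ ^ 2) + 1 / 2 * (b * ‖v p.2‖ ^ 2)) := by gcongr
      _ = _ := by ring
  have hsum := (a1.const_mul (1 / 2)).add (b3.const_mul (1 / 2))
  have hmeas : AEStronglyMeasurable (fun p : ℝ × ℝ => K p * (u p.1 * conj (v p.2)))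
      (volume : Measure (ℝ × ℝ)) :=
    hK.aestronglyMeasurable.mul (hu.1.comp_fst.mul
      (RCLike.continuous_conj.comp_aestronglyMeasurable hv.1.comp_snd))
  refine ⟨hsum.mono' hmeas hle, ?_⟩
  refine (norm_integral_le_of_norm_le hsum hle).trans_eq ?_
  rw [integral_add' (a1.const_mul (1 / 2)) (b3.const_mul (1 / 2)), integral_const_mul, a2]
  simp only [Function.comp_def, Prod.fst_swap, Prod.snd_swap] at b4 ⊢
  rw [integral_const_mul, b4]
  ring

/-- The part of the half-plane `{s + t ≥ 0}` outside of the quarter-plane `{s ≥ 0, t ≥ 0}`. -/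
def crossRegion : Set (ℝ × ℝ) := {p | 0 ≤ p.1 + p.2 ∧ (p.1 < 0 ∨ p.2 < 0)}

theorem measurableSet_crossRegion : MeasurableSet crossRegion := by
  unfold crossRegion
  measurability

theorem max_abs_le_of_mem_crossRegion {p : ℝ × ℝ} (hp : p ∈ crossRegion) :
    max |p.1| |p.2| ≤ |p.1 - p.2| := by
  obtain ⟨h1, h2⟩ := hp
  rcases h2 with h2 | h2
  · rw [abs_of_neg h2, abs_of_nonneg (by linarith : 0 ≤ p.2), abs_of_neg (by linarith)]
    exact max_le (by linarith) (by linarith)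
  · rw [abs_of_neg h2, abs_of_nonneg (by linarith : 0 ≤ p.1), abs_of_pos (by linarith)]
    exact max_le (by linarith) (by linarith)

theorem max_abs_pos_of_mem_crossRegion {p : ℝ × ℝ} (hp : p ∈ crossRegion) :
    0 < max |p.1| |p.2| := by
  obtain ⟨h1, h2⟩ := hp
  rcases h2 with h2 | h2
  · exact lt_max_of_lt_left (abs_pos.2 h2.ne)
  · exact lt_max_of_lt_right (abs_pos.2 h2.ne)

/-- The integral kernel `1 / (2πi (s - t))`, cut off to `crossRegion`. -/
noncomputable def crossKernel : ℝ × ℝ → ℂ :=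
  crossRegion.indicator fun p => (2 * Real.pi * Complex.I * (p.1 - p.2))⁻¹

theorem measurable_crossKernel : Measurable crossKernel :=
  Measurable.indicator (by fun_prop) measurableSet_crossRegion

theorem norm_crossKernel_le (p : ℝ × ℝ) : ‖crossKernel p‖ ≤ (max |p.1| |p.2|)⁻¹ := by
  by_cases hp : p ∈ crossRegion
  · rw [crossKernel, Set.indicator_of_mem hp, norm_inv]
    apply inv_anti₀ (max_abs_pos_of_mem_crossRegion hp)
    refine (max_abs_le_of_mem_crossRegion hp).trans ?_
    rw [norm_mul, ← Complex.ofReal_sub, Complex.norm_real, Real.norm_eq_abs]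
    refine le_mul_of_one_le_left (abs_nonneg _) ?_
    have : ‖(2 * Real.pi * Complex.I : ℂ)‖ = 2 * Real.pi := by
      simp [abs_of_pos Real.pi_pos]
    rw [this]
    linarith [Real.pi_gt_three]
  · rw [crossKernel, Set.indicator_of_notMem hp, norm_zero]
    positivity

theorem crossKernel_swap (p : ℝ × ℝ) : crossKernel p.swap = conj (crossKernel p) := by
  have h : p.swap ∈ crossRegion ↔ p ∈ crossRegion := by
    simp [crossRegion, add_comm, or_comm]
  by_cases hp : p ∈ crossRegion
  · rw [crossKernel, Set.indicator_of_mem hp, Set.indicator_of_mem (h.2 hp), map_inv₀]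
    congr 1
    simp [map_ofNat]
    ring
  · rw [crossKernel, Set.indicator_of_notMem hp, Set.indicator_of_notMem (fun h' => hp (h.1 h')),
      map_zero]

/-- The sesquilinear form `∬ K(s,t) u(s) conj(v(t)) ds dt`, `K` being `crossKernel`. -/
noncomputable def crossForm (v u : Lp ℂ 2 (volume : Measure ℝ)) : ℂ :=
  ∫ p : ℝ × ℝ, crossKernel p * (u p.1 * conj (v p.2))

theorem integrable_crossForm (v u : Lp ℂ 2 (volume : Measure ℝ)) :
    Integrable (fun p : ℝ × ℝ => crossKernel p * (u p.1 * conj (v p.2))) volume :=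
  (integrable_kernel_mul measurable_crossKernel norm_crossKernel_le (Lp.memLp u) (Lp.memLp v)).1

theorem crossForm_congr {v u : Lp ℂ 2 (volume : Measure ℝ)} {f g : ℝ → ℂ}
    (hu : u =ᵐ[volume] f) (hv : v =ᵐ[volume] g) :
    crossForm v u = ∫ p : ℝ × ℝ, crossKernel p * (f p.1 * conj (g p.2)) := by
  refine integral_congr_ae ?_
  filter_upwards [Measure.quasiMeasurePreserving_fst.ae_eq_comp hu,
    Measure.quasiMeasurePreserving_snd.ae_eq_comp hv] with p h1 h2
  simp only [Function.comp_apply] at h1 h2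
  rw [h1, h2]

theorem crossForm_add_right (v u w : Lp ℂ 2 (volume : Measure ℝ)) :
    crossForm v (u + w) = crossForm v u + crossForm v w := by
  rw [crossForm_congr (Lp.coeFn_add u w) (Filter.EventuallyEq.refl _ v), crossForm, crossForm,
    ← integral_add (integrable_crossForm v u) (integrable_crossForm v w)]
  congr 1
  ext p
  simp only [Pi.add_apply]
  ring

theorem crossForm_smul_right (c : ℂ) (v u : Lp ℂ 2 (volume : Measure ℝ)) :
    crossForm v (c • u) = c * crossForm v u := by
  rw [crossForm_congr (Lp.coeFn_smul c u) (Filter.EventuallyEq.refl _ v), crossForm,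
    ← integral_const_mul]
  congr 1
  ext p
  simp only [Pi.smul_apply, smul_eq_mul]
  ring

theorem conj_crossForm (v u : Lp ℂ 2 (volume : Measure ℝ)) :
    conj (crossForm v u) = crossForm u v := by
  rw [crossForm, crossForm, ← integral_conj, Measure.volume_eq_prod, ← integral_prod_swap]
  congr 1
  ext p
  have := crossKernel_swap p.swap
  rw [Prod.swap_swap] at this
  rw [map_mul, ← this]
  simp only [Prod.fst_swap, Prod.snd_swap, map_mul, Complex.conj_conj]
  ring

theorem norm_crossForm_le (v u : Lp ℂ 2 (volume : Measure ℝ)) :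
    ‖crossForm v u‖ ≤ 8 * ‖v‖ * ‖u‖ := by
  have h0 : ∀ v u : Lp ℂ 2 (volume : Measure ℝ), ‖crossForm v u‖ ≤ 4 * ‖u‖ ^ 2 + 4 * ‖v‖ ^ 2 := by
    intro v u
    rw [Lp.norm_sq_eq_integral, Lp.norm_sq_eq_integral]
    exact (integrable_kernel_mul measurable_crossKernel norm_crossKernel_le
      (Lp.memLp u) (Lp.memLp v)).2
  have hsl : ∀ (c : ℂ) (v u : Lp ℂ 2 (volume : Measure ℝ)),
      crossForm (c • v) u = conj c * crossForm v u := by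
    intro c v u
    rw [← conj_crossForm, crossForm_smul_right, map_mul, conj_crossForm]
  by_cases hu : u = 0
  · have := crossForm_smul_right 0 v u
    rw [zero_smul, zero_mul] at this
    rw [hu, this]
    simp
  by_cases hv : v = 0
  · have := hsl 0 v u
    rw [zero_smul, map_zero, zero_mul] at this
    rw [hv, this]
    simp
  have h := h0 (((‖v‖⁻¹ : ℝ) : ℂ) • v) (((‖u‖⁻¹ : ℝ) : ℂ) • u)
  have hu' := norm_pos_iff.2 hu
  have hv' := norm_pos_iff.2 hv
  rw [hsl, crossForm_smul_right, norm_mul, norm_mul, norm_smul, norm_smul, RCLike.norm_conj] at h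
  simp only [Complex.norm_real, norm_inv, norm_norm] at h
  rw [inv_mul_cancel₀ hu'.ne', inv_mul_cancel₀ hv'.ne', ← mul_assoc, ← mul_inv,
    inv_mul_le_iff₀ (by positivity)] at h
  linarith

/-- The bounded operator on `L²(ℝ)` with integral kernel `crossKernel`. -/
noncomputable def crossOperator :
    Lp ℂ 2 (volume : Measure ℝ) →L[ℂ] Lp ℂ 2 (volume : Measure ℝ) :=
  InnerProductSpace.continuousLinearMapOfBilin
    (LinearMap.mkContinuous₂
      (LinearMap.mk₂'ₛₗ (starRingEnd ℂ) (RingHom.id ℂ) crossForm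
        (fun v w u => by
          rw [← conj_crossForm, crossForm_add_right, map_add, conj_crossForm, conj_crossForm])
        (fun c v u => by
          rw [← conj_crossForm, crossForm_smul_right, map_mul, conj_crossForm, smul_eq_mul])
        crossForm_add_right
        (fun c v u => crossForm_smul_right c v u)) 8 norm_crossForm_le)

theorem inner_crossOperator_left (v u : Lp ℂ 2 (volume : Measure ℝ)) :
    inner ℂ (crossOperator v) u = crossForm v u := by
  rw [crossOperator, InnerProductSpace.continuousLinearMapOfBilin_apply]
  rfl

theorem inner_crossOperator (v u : Lp ℂ 2 (volume : Measure ℝ)) :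
    inner ℂ v (crossOperator u) = crossForm v u := by
  rw [← inner_conj_symm, inner_crossOperator_left, conj_crossForm]

/-- The Weyl quantization of the indicator function of the quarter-plane. -/
noncomputable def quarterPlaneOperator :
    Lp ℂ 2 (volume : Measure ℝ) →L[ℂ] Lp ℂ 2 (volume : Measure ℝ) :=
  ContinuousLinearMap.adjoint halfLineFourier ∘L halfLineFourier + crossOperator

theorem inner_quarterPlaneOperator (v u : Lp ℂ 2 (volume : Measure ℝ)) :
    inner ℂ v (quarterPlaneOperator u) =
      inner ℂ (halfLineFourier v) (halfLineFourier u) + crossForm v u := by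
  rw [quarterPlaneOperator, add_apply, inner_add_right,
    ContinuousLinearMap.comp_apply, ContinuousLinearMap.adjoint_inner_right, inner_crossOperator]

theorem isSelfAdjoint_quarterPlaneOperator : IsSelfAdjoint quarterPlaneOperator := by
  rw [ContinuousLinearMap.isSelfAdjoint_iff_isSymmetric]
  intro v u
  change inner ℂ (quarterPlaneOperator v) u = inner ℂ v (quarterPlaneOperator u)
  rw [← inner_conj_symm, inner_quarterPlaneOperator, inner_quarterPlaneOperator, map_add,
    conj_crossForm, inner_conj_symm]

theorem measurePreserving_midpoint_difference :
    MeasurePreserving (fun p : ℝ × ℝ => (p.1 + p.2 / 2, p.1 - p.2 / 2)) volume volume := by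
  have h1 : MeasurePreserving (fun q : ℝ × ℝ => (q.1, q.2 - q.1 / 2))
      ((volume : Measure ℝ).prod volume) ((volume : Measure ℝ).prod volume) :=
    (MeasurePreserving.id volume).skew_product (g := fun z x => x - z / 2)
      (by fun_prop) (Filter.Eventually.of_forall fun z => map_sub_right_eq_self volume (z / 2))
  have h2 : MeasurePreserving (fun q : ℝ × ℝ => (q.1, q.2 + q.1))
      ((volume : Measure ℝ).prod volume) ((volume : Measure ℝ).prod volume) :=
    (MeasurePreserving.id volume).skew_product (g := fun t z => z + t)
      (by fun_prop) (Filter.Eventually.of_forall fun t => map_add_right_eq_self volume t)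
  have h3 := Measure.measurePreserving_swap (μ := (volume : Measure ℝ))
    (ν := (volume : Measure ℝ))
  have h := h3.comp (h2.comp (h3.comp (h1.comp h3)))
  convert! h using 1
  ext p <;> simp
  ring

theorem integral_exp_neg_mul_Ici {ε z : ℝ} (hε : 0 < ε) :
    ∫ ξ in Set.Ici (0 : ℝ), Complex.exp (-(2 * Real.pi * ε) * ξ) *
      Complex.exp (-2 * Real.pi * Complex.I * z * ξ) =
      (2 * Real.pi * (ε + Complex.I * z))⁻¹ := by
  have hre : (-(2 * Real.pi * (ε + Complex.I * z)) : ℂ).re < 0 := by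
    have := Real.pi_pos
    simp
    positivity
  have h := integral_exp_mul_complex_Ioi hre 0
  rw [integral_Ici_eq_integral_Ioi]
  simp only [Complex.ofReal_zero, mul_zero, Complex.exp_zero] at h
  rw [inv_eq_one_div, ← neg_div_neg_eq, ← h]
  congr 1
  ext ξ
  rw [← Complex.exp_add]
  congr 1
  ring

theorem norm_exp_neg_eps (ε ξ : ℝ) :
    ‖Complex.exp (-(2 * Real.pi * ε) * ξ)‖ = Real.exp (-(2 * Real.pi * ε) * ξ) := by
  rw [Complex.norm_exp]
  congr 1
  simp

theorem integral_abel_regularized {ε : ℝ} (hε : 0 < ε) {h : ℝ × ℝ → ℂ} {s : Set (ℝ × ℝ)}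
    (hh : IntegrableOn h s volume) :
    ∫ ξ in Set.Ici (0 : ℝ), Complex.exp (-(2 * Real.pi * ε) * ξ) *
        (∫ p in s, Complex.exp (-2 * Real.pi * Complex.I * ((p.1 - p.2 : ℝ) : ℂ) * ξ) * h p) =
      ∫ p in s, (2 * Real.pi * (ε + Complex.I * ((p.1 - p.2 : ℝ) : ℂ)))⁻¹ * h p := by
  have hpos : 0 < 2 * Real.pi * ε := by positivity
  have hexp : IntegrableOn (fun ξ : ℝ => Real.exp (-(2 * Real.pi * ε) * ξ)) (Set.Ici 0) := by
    rw [integrableOn_Ici_iff_integrableOn_Ioi]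
    exact integrableOn_exp_mul_Ioi (by linarith) 0
  have hF : Integrable (Function.uncurry fun (ξ : ℝ) (p : ℝ × ℝ) =>
      Complex.exp (-(2 * Real.pi * ε) * ξ) *
        (Complex.exp (-2 * Real.pi * Complex.I * ((p.1 - p.2 : ℝ) : ℂ) * ξ) * h p))
      ((volume.restrict (Set.Ici (0 : ℝ))).prod (volume.restrict s)) := by
    refine Integrable.mono' (hexp.mul_prod hh.norm) ?_ (Filter.Eventually.of_forall fun q => ?_)
    · refine AEStronglyMeasurable.mul (Continuous.aestronglyMeasurable (by fun_prop))
        (AEStronglyMeasurable.mul (Continuous.aestronglyMeasurable (by fun_prop)) ?_)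
      exact hh.1.comp_snd
    · simp only [Function.uncurry]
      rw [norm_mul, norm_mul, norm_exp_two_pi, norm_exp_neg_eps, one_mul]
  calc _ = ∫ ξ in Set.Ici (0 : ℝ), ∫ p in s, Complex.exp (-(2 * Real.pi * ε) * ξ) *
        (Complex.exp (-2 * Real.pi * Complex.I * ((p.1 - p.2 : ℝ) : ℂ) * ξ) * h p) := by
        congr 1
        ext ξ
        rw [integral_const_mul]
    _ = ∫ p in s, ∫ ξ in Set.Ici (0 : ℝ), Complex.exp (-(2 * Real.pi * ε) * ξ) *
        (Complex.exp (-2 * Real.pi * Complex.I * ((p.1 - p.2 : ℝ) : ℂ) * ξ) * h p) :=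
        integral_integral_swap hF
    _ = _ := by
        congr 1
        ext p
        simp_rw [← mul_assoc]
        rw [integral_mul_const]
        congr 1
        simpa only [mul_assoc] using integral_exp_neg_mul_Ici (z := p.1 - p.2) hε

open Filter Topology in
theorem integral_oscillatory_crossRegion {h : ℝ × ℝ → ℂ} (hh : Integrable h volume)
    (hK : Integrable (fun p => crossKernel p * h p) volume)
    (hR : IntegrableOn (fun ξ : ℝ => ∫ p in crossRegion,
      Complex.exp (-2 * Real.pi * Complex.I * ((p.1 - p.2 : ℝ) : ℂ) * ξ) * h p) (Set.Ici 0)) :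
    ∫ ξ in Set.Ici (0 : ℝ), (∫ p in crossRegion,
      Complex.exp (-2 * Real.pi * Complex.I * ((p.1 - p.2 : ℝ) : ℂ) * ξ) * h p) =
      ∫ p, crossKernel p * h p := by
  have hKi : (fun p => crossKernel p * h p) = crossRegion.indicator
      (fun p => (2 * Real.pi * Complex.I * (p.1 - p.2))⁻¹ * h p) := by
    ext p
    by_cases hp : p ∈ crossRegion <;> simp [crossKernel, hp]
  rw [hKi] at hK ⊢
  rw [integrable_indicator_iff measurableSet_crossRegion] at hK
  rw [integral_indicator measurableSet_crossRegion]
  have L1 : Tendsto (fun ε : ℝ => ∫ ξ in Set.Ici (0 : ℝ),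
      Complex.exp (-(2 * Real.pi * ε) * ξ) * (∫ p in crossRegion,
        Complex.exp (-2 * Real.pi * Complex.I * ((p.1 - p.2 : ℝ) : ℂ) * ξ) * h p)) (𝓝[>] 0)
      (𝓝 (∫ ξ in Set.Ici (0 : ℝ), (∫ p in crossRegion,
        Complex.exp (-2 * Real.pi * Complex.I * ((p.1 - p.2 : ℝ) : ℂ) * ξ) * h p))) := by
    refine tendsto_integral_filter_of_dominated_convergence _ ?_ ?_ hR.norm ?_
    · exact Eventually.of_forall fun ε =>
        (Continuous.aestronglyMeasurable (by fun_prop)).mul hR.1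
    · filter_upwards [self_mem_nhdsWithin] with ε hε
      filter_upwards [ae_restrict_mem measurableSet_Ici] with ξ hξ
      rw [norm_mul, norm_exp_neg_eps]
      refine mul_le_of_le_one_left (norm_nonneg _) (Real.exp_le_one_iff.2 ?_)
      have : 0 ≤ 2 * Real.pi * ε * ξ :=
        mul_nonneg (mul_nonneg Real.two_pi_pos.le (le_of_lt hε)) hξ
      linarith
    · refine Eventually.of_forall fun ξ => ?_
      have hc : Continuous (fun ε : ℝ => Complex.exp (-(2 * Real.pi * ε) * ξ) *
          (∫ p in crossRegion,
            Complex.exp (-2 * Real.pi * Complex.I * ((p.1 - p.2 : ℝ) : ℂ) * ξ) * h p)) := by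
        fun_prop
      have := (hc.tendsto 0).mono_left (nhdsWithin_le_nhds (s := Set.Ioi 0))
      simpa using this
  have L2 : Tendsto (fun ε : ℝ => ∫ p in crossRegion,
      (2 * Real.pi * (ε + Complex.I * ((p.1 - p.2 : ℝ) : ℂ)))⁻¹ * h p) (𝓝[>] 0)
      (𝓝 (∫ p in crossRegion, (2 * Real.pi * Complex.I * (p.1 - p.2))⁻¹ * h p)) := by
    refine tendsto_integral_filter_of_dominated_convergence _ ?_ ?_ hK.norm ?_
    · exact Eventually.of_forall fun ε =>
        (Measurable.aestronglyMeasurable (by fun_prop)).mul hh.1.restrict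
    · filter_upwards [self_mem_nhdsWithin] with ε hε
      filter_upwards [ae_restrict_mem measurableSet_crossRegion] with p hp
      rw [norm_mul, norm_mul]
      gcongr ?_ * _
      have hp0 : 0 < |p.1 - p.2| :=
        (max_abs_pos_of_mem_crossRegion hp).trans_le (max_abs_le_of_mem_crossRegion hp)
      have e : ‖(2 * Real.pi * Complex.I * (p.1 - p.2) : ℂ)‖ = 2 * Real.pi * |p.1 - p.2| := by
        rw [← Complex.ofReal_sub]
        simp [abs_of_pos Real.pi_pos, -Complex.ofReal_sub]
      rw [norm_inv, norm_inv, e]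
      apply inv_anti₀ (by positivity)
      rw [norm_mul]
      have e2 : ‖(2 * Real.pi : ℂ)‖ = 2 * Real.pi := by simp [abs_of_pos Real.pi_pos]
      rw [e2]
      gcongr
      refine le_trans ?_ (Complex.abs_im_le_norm _)
      simp
    · filter_upwards [ae_restrict_mem measurableSet_crossRegion] with p hp
      have hp0 : 0 < |p.1 - p.2| :=
        (max_abs_pos_of_mem_crossRegion hp).trans_le (max_abs_le_of_mem_crossRegion hp)
      have hc : ContinuousAt (fun ε : ℝ =>
          (2 * Real.pi * (ε + Complex.I * ((p.1 - p.2 : ℝ) : ℂ)))⁻¹ * h p) 0 := by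
        refine ContinuousAt.mul (ContinuousAt.inv₀ (by fun_prop) ?_) continuousAt_const
        simp only [Complex.ofReal_zero, zero_add]
        have := Real.pi_ne_zero
        simpa [this, -Complex.ofReal_sub] using abs_pos.1 hp0
      have := hc.tendsto.mono_left (nhdsWithin_le_nhds (s := Set.Ioi 0))
      convert! this using 2
      push_cast
      ring
  refine tendsto_nhds_unique L1 (L2.congr' ?_)
  filter_upwards [self_mem_nhdsWithin] with ε hε
  exact (integral_abel_regularized hε hh.integrableOn).symm

theorem quarterPlaneSymbol_mul (F : ℝ × ℝ → ℂ) :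
    (fun p => quarterPlaneSymbol p * F p) =
      (Set.Ici (0 : ℝ) ×ˢ Set.Ici (0 : ℝ)).indicator F := by
  ext p
  by_cases h1 : 0 ≤ p.1 <;> by_cases h2 : 0 ≤ p.2 <;>
    simp [quarterPlaneSymbol, heavisideFn, Set.indicator, Prod.le_def, h1, h2]

theorem Schwartz.integrable_tensor (u v : 𝓢(ℝ, ℂ)) :
    Integrable (fun p : ℝ × ℝ => u p.1 * conj (v p.2)) volume :=
  u.integrable.mul_prod
    ((RCLike.conjLIE (K := ℂ)).toContinuousLinearEquiv.integrable_comp_iff.2 v.integrable)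

theorem integral_wignerFn_position (u v : 𝓢(ℝ, ℂ)) (ξ : ℝ) :
    ∫ x in Set.Ici (0 : ℝ), wignerFn u v (x, ξ) =
      ∫ p in {p : ℝ × ℝ | 0 ≤ p.1 + p.2},
        Complex.exp (-2 * Real.pi * Complex.I * ((p.1 - p.2 : ℝ) : ℂ) * ξ) *
          (u p.1 * conj (v p.2)) := by
  have hm : MeasurableSet {p : ℝ × ℝ | 0 ≤ p.1 + p.2} := measurableSet_le (by fun_prop) (by fun_prop)
  have hi : Integrable (fun p : ℝ × ℝ =>
      Complex.exp (-2 * Real.pi * Complex.I * p.2 * ξ) * wignerKernel u v p) volume :=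
    (integrable_wignerKernel u v).bdd_mul (c := 1)
      (Continuous.aestronglyMeasurable (by fun_prop))
      (Filter.Eventually.of_forall fun p => (norm_exp_two_pi p.2 ξ).le)
  have h1 : ∫ x in Set.Ici (0 : ℝ), wignerFn u v (x, ξ) = 
      ∫ p : ℝ × ℝ in Set.Ici (0 : ℝ) ×ˢ Set.univ, Complex.exp (-2 * Real.pi * Complex.I * p.2 * ξ) * wignerKernel u v p := by
    rw [Measure.volume_eq_prod, setIntegral_prod _ hi.integrableOn]
    simp only [Measure.restrict_univ]
    rfl
  rw [h1, ← integral_indicator (measurableSet_Ici.prod MeasurableSet.univ),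
    ← integral_indicator hm]
  nth_rewrite 2 [← measurePreserving_midpoint_difference.map_eq]
  have hcu := u.continuous
  have hcv := v.continuous
  rw [integral_map measurePreserving_midpoint_difference.measurable.aemeasurable
    ((Measurable.indicator (Continuous.measurable (by fun_prop)) hm).aestronglyMeasurable)]
  congr 1
  ext p
  have e : p.1 + p.2 / 2 + (p.1 - p.2 / 2) = 2 * p.1 := by ring
  have e' : p.1 + p.2 / 2 - (p.1 - p.2 / 2) = p.2 := by ring
  by_cases hp : 0 ≤ p.1
  · rw [Set.indicator_of_mem (by simpa using hp),
      Set.indicator_of_mem (by simp only [Set.mem_ofPred_eq]; linarith)]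
    simp only [e']
    rfl
  · rw [Set.indicator_of_notMem (by simpa using hp),
      Set.indicator_of_notMem (by simp only [Set.mem_ofPred_eq]; linarith)]

open FourierTransform in
theorem integral_wignerFn_position_eq (u v : 𝓢(ℝ, ℂ)) (ξ : ℝ) :
    ∫ x in Set.Ici (0 : ℝ), wignerFn u v (x, ξ) =
      𝓕 ((Set.Ici (0 : ℝ)).indicator u) ξ * conj (𝓕 ((Set.Ici (0 : ℝ)).indicator v) ξ) +
      ∫ p in crossRegion, Complex.exp (-2 * Real.pi * Complex.I * ((p.1 - p.2 : ℝ) : ℂ) * ξ) *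
          (u p.1 * conj (v p.2)) := by
  have hi : Integrable (fun p : ℝ × ℝ =>
      Complex.exp (-2 * Real.pi * Complex.I * ((p.1 - p.2 : ℝ) : ℂ) * ξ) *
        (u p.1 * conj (v p.2))) volume :=
    (Schwartz.integrable_tensor u v).bdd_mul (c := 1)
      (Continuous.aestronglyMeasurable (by fun_prop))
      (Filter.Eventually.of_forall fun p => (norm_exp_two_pi (p.1 - p.2) ξ).le)
  have hset : {p : ℝ × ℝ | 0 ≤ p.1 + p.2} = (Set.Ici (0 : ℝ) ×ˢ Set.Ici (0 : ℝ)) ∪ crossRegion := by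
    ext p
    simp only [Set.mem_ofPred_eq, crossRegion, Set.mem_union, Set.mem_prod, Set.mem_Ici]
    constructor
    · intro h
      by_cases h1 : 0 ≤ p.1 ∧ 0 ≤ p.2
      · exact Or.inl h1
      · refine Or.inr ⟨h, ?_⟩
        rw [not_and_or, not_le, not_le] at h1
        exact h1
    · rintro (h | h)
      · linarith [h.1, h.2]
      · exact h.1
  have hdisj : Disjoint (Set.Ici (0 : ℝ) ×ˢ Set.Ici (0 : ℝ)) crossRegion := by
    rw [Set.disjoint_left]
    rintro p ⟨h1, h2⟩ ⟨-, h3⟩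
    simp only [Set.mem_Ici] at h1 h2
    rcases h3 with h3 | h3 <;> linarith
  rw [integral_wignerFn_position, hset, setIntegral_union hdisj measurableSet_crossRegion
    hi.integrableOn hi.integrableOn]
  congr 1
  have hF : ∀ w : 𝓢(ℝ, ℂ), 𝓕 ((Set.Ici (0 : ℝ)).indicator w) ξ =
      ∫ s in Set.Ici (0 : ℝ), Complex.exp (-2 * Real.pi * Complex.I * s * ξ) * w s := by
    intro w
    rw [Real.fourier_eq', ← integral_indicator measurableSet_Ici]
    congr 1
    ext s
    by_cases hs : s ∈ Set.Ici (0 : ℝ)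
    · rw [Set.indicator_of_mem hs, Set.indicator_of_mem hs, smul_eq_mul]
      congr 2
      simp
      ring
    · simp [hs]
  rw [hF, hF, ← integral_conj, Measure.volume_eq_prod, ← setIntegral_prod_mul]
  congr 1
  ext p
  rw [map_mul, ← Complex.exp_conj]
  have : Complex.exp (-2 * Real.pi * Complex.I * ((p.1 - p.2 : ℝ) : ℂ) * ξ) =
      Complex.exp (-2 * Real.pi * Complex.I * p.1 * ξ) *
        Complex.exp (conj (-2 * Real.pi * Complex.I * p.2 * ξ)) := by
    rw [← Complex.exp_add]
    congr 1
    simp [map_ofNat]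
    ring
  rw [this]
  ring

/-- `quarterPlaneOperator` is the Weyl quantization of the indicator function of the
quarter-plane. -/
theorem isWeylQuantization_quarterPlaneOperator :
    IsWeylQuantization quarterPlaneSymbol quarterPlaneOperator := by
  intro u v
  have hW := integrable_wignerFn u v
  have hS : MeasurableSet (Set.Ici (0 : ℝ) ×ˢ Set.Ici (0 : ℝ)) :=
    measurableSet_Ici.prod measurableSet_Ici
  rw [quarterPlaneSymbol_mul]
  refine ⟨hW.indicator hS, ?_⟩
  rw [integral_indicator hS]
  have hW' : Integrable (wignerFn u v)
      ((volume.restrict (Set.Ici (0 : ℝ))).prod (volume.restrict (Set.Ici (0 : ℝ)))) := by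
    rw [Measure.prod_restrict, ← Measure.volume_eq_prod]
    exact hW.integrableOn
  have hI := hW'.integral_prod_right
  rw [Measure.volume_eq_prod, ← Measure.prod_restrict, integral_prod_symm _ hW']
  simp only [integral_wignerFn_position_eq] at hI ⊢
  have hu : (Set.Ici (0 : ℝ)).indicator (u.toLp 2 volume) =ᵐ[volume]
      (Set.Ici (0 : ℝ)).indicator u :=
    (u.coeFn_toLp 2 volume).indicator
  have hv : (Set.Ici (0 : ℝ)).indicator (v.toLp 2 volume) =ᵐ[volume]
      (Set.Ici (0 : ℝ)).indicator v :=
    (v.coeFn_toLp 2 volume).indicator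
  obtain ⟨f1, f2⟩ := inner_halfLineFourier (u.toLp 2 volume) (v.toLp 2 volume) hu
    (u.integrable.indicator measurableSet_Ici) hv (v.integrable.indicator measurableSet_Ici)
  have hR : IntegrableOn (fun ξ : ℝ => ∫ p in crossRegion,
      Complex.exp (-2 * Real.pi * Complex.I * ((p.1 - p.2 : ℝ) : ℂ) * ξ) *
        (u p.1 * conj (v p.2))) (Set.Ici 0) := by
    refine (hI.sub f1).congr (Filter.Eventually.of_forall fun ξ => ?_)
    simp
  rw [integral_add f1 hR, inner_quarterPlaneOperator, f2, integral_oscillatory_crossRegion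
    (Schwartz.integrable_tensor u v) _ hR,
    crossForm_congr (u.coeFn_toLp 2 volume) (v.coeFn_toLp 2 volume)]
  exact (integrable_kernel_mul measurable_crossKernel norm_crossKernel_le
    (u.memLp 2 volume) (v.memLp 2 volume)).1

/-- A bounded operator is determined by its symbol. -/
theorem IsWeylQuantization.unique {a : ℝ × ℝ → ℂ}
    {A B : Lp ℂ 2 (volume : Measure ℝ) →L[ℂ] Lp ℂ 2 (volume : Measure ℝ)}
    (hA : IsWeylQuantization a A) (hB : IsWeylQuantization a B) : B = A := by
  have hd : DenseRange (SchwartzMap.toLpCLM ℂ (E := ℝ) ℂ 2 volume) :=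
    SchwartzMap.denseRange_toLpCLM ENNReal.ofNat_ne_top
  apply ContinuousLinearMap.coeFn_injective
  refine hd.equalizer B.continuous A.continuous (funext fun u => ?_)
  refine hd.eq_of_inner_right ℂ fun v => ?_
  exact ((hB u v).2.trans (hA u v).2.symm)

/-- The function `t ↦ t ^ (a - 1) * exp (-t)` on the positive half-line, extended by zero. -/
noncomputable def gammaDensity (a : ℂ) : ℝ → ℂ :=
  (Set.Ioi (0 : ℝ)).indicator fun t => Complex.exp (-t) * (t : ℂ) ^ (a - 1)

theorem integrable_gammaDensity {a : ℂ} (ha : 0 < a.re) :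
    Integrable (gammaDensity a) volume := by
  rw [gammaDensity, integrable_indicator_iff measurableSet_Ioi]
  simpa using Complex.GammaIntegral_convergent ha

open FourierTransform in
theorem fourier_gammaDensity_eq (a : ℂ) (ξ : ℝ) :
    𝓕 (gammaDensity a) ξ = ∫ t in Set.Ioi (0 : ℝ),
      Complex.exp (-(1 + 2 * Real.pi * Complex.I * ξ) * t) * (t : ℂ) ^ (a - 1) := by
  rw [Real.fourier_eq', ← integral_indicator measurableSet_Ioi]
  congr 1
  ext t
  by_cases ht : t ∈ Set.Ioi (0 : ℝ)
  · rw [gammaDensity, Set.indicator_of_mem ht, Set.indicator_of_mem ht, smul_eq_mul, ← mul_assoc,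
      ← Complex.exp_add]
    congr 2
    simp
    ring
  · simp [gammaDensity, ht]

theorem integrableOn_exp_mul_cpow {a : ℂ} (ha : 0 < a.re) (ξ : ℝ) :
    IntegrableOn (fun t : ℝ =>
      Complex.exp (-(1 + 2 * Real.pi * Complex.I * ξ) * t) * (t : ℂ) ^ (a - 1)) (Set.Ioi 0) := by
  have h : IntegrableOn (fun t : ℝ => Complex.exp (-t) * (t : ℂ) ^ (a - 1)) (Set.Ioi 0) := by
    simpa using Complex.GammaIntegral_convergent ha
  have h2 := Integrable.bdd_mul (c := 1) h
    (f := fun t : ℝ => Complex.exp (-2 * Real.pi * Complex.I * t * ξ))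
    (Continuous.aestronglyMeasurable (by fun_prop))
    (Filter.Eventually.of_forall fun t => (norm_exp_two_pi t ξ).le)
  refine h2.congr (Filter.Eventually.of_forall fun t => ?_)
  simp only
  rw [← mul_assoc, ← Complex.exp_add]
  congr 2
  ring

open FourierTransform Filter Topology in
theorem mul_fourier_gammaDensity_add_one {a : ℂ} (ha : 0 < a.re) (ξ : ℝ) :
    (1 + 2 * Real.pi * Complex.I * ξ) * 𝓕 (gammaDensity (a + 1)) ξ = a * 𝓕 (gammaDensity a) ξ := by
  set r : ℂ := 1 + 2 * Real.pi * Complex.I * ξ with hr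
  have ha0 : a ≠ 0 := by rintro rfl; simp at ha
  have i1 := integrableOn_exp_mul_cpow ha ξ
  have i2 := integrableOn_exp_mul_cpow (a := a + 1) (by simp; linarith) ξ
  rw [← hr] at i1 i2
  rw [add_sub_cancel_right] at i2
  have hd : ∀ t ∈ Set.Ioi (0 : ℝ), HasDerivAt (fun t : ℝ => Complex.exp (-r * t) * (t : ℂ) ^ a)
      (a * (Complex.exp (-r * t) * (t : ℂ) ^ (a - 1)) -
        r * (Complex.exp (-r * t) * (t : ℂ) ^ a)) t := by
    intro t ht
    have h0 : HasDerivAt (fun t : ℝ => (t : ℂ)) 1 t := Complex.ofRealCLM.hasDerivAt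
    have h1 := (h0.const_mul (-r)).cexp
    have h2 := hasDerivAt_ofReal_cpow_const (x := t) (ne_of_gt ht) ha0
    convert! h1.mul h2 using 1
    ring
  have i3 : IntegrableOn (fun t : ℝ => a * (Complex.exp (-r * t) * (t : ℂ) ^ (a - 1)) -
      r * (Complex.exp (-r * t) * (t : ℂ) ^ a)) (Set.Ioi 0) := (i1.const_mul a).sub (i2.const_mul r)
  have ht := tendsto_zero_of_hasDerivAt_of_integrableOn_Ioi hd i3 i2
  have hc : ContinuousWithinAt (fun t : ℝ => Complex.exp (-r * t) * (t : ℂ) ^ a)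
      (Set.Ici 0) 0 := by
    refine ContinuousAt.continuousWithinAt (ContinuousAt.mul (by fun_prop) ?_)
    exact Complex.continuousAt_ofReal_cpow_const 0 a (Or.inl ha)
  have h := integral_Ioi_of_hasDerivAt_of_tendsto hc hd i3 ht
  rw [integral_sub (i1.const_mul a) (i2.const_mul r), integral_const_mul, integral_const_mul] at h
  simp only [Complex.ofReal_zero, Complex.zero_cpow ha0, mul_zero, sub_zero] at h
  rw [fourier_gammaDensity_eq, fourier_gammaDensity_eq, add_sub_cancel_right, ← hr]
  linear_combination -h

open FourierTransform in
theorem hasDerivAt_fourier_gammaDensity {a : ℂ} (ha : 0 < a.re) (ξ : ℝ) :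
    HasDerivAt (𝓕 (gammaDensity a))
      (-(2 * Real.pi * Complex.I) * 𝓕 (gammaDensity (a + 1)) ξ) ξ := by
  have e : ∀ t : ℝ, t • gammaDensity a t = gammaDensity (a + 1) t := by
    intro t
    by_cases ht : t ∈ Set.Ioi (0 : ℝ)
    · have ht0 : (t : ℂ) ≠ 0 := by exact_mod_cast ne_of_gt ht
      rw [gammaDensity, gammaDensity, Set.indicator_of_mem ht, Set.indicator_of_mem ht,
        Complex.real_smul, add_sub_cancel_right, Complex.cpow_sub _ _ ht0, Complex.cpow_one]
      field_simp
    · simp [gammaDensity, ht]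
  have h := Real.hasDerivAt_fourier (integrable_gammaDensity ha)
    ((integrable_gammaDensity (a := a + 1) (by simp; linarith)).congr
      (Filter.Eventually.of_forall fun t => (e t).symm)) ξ
  convert! h using 1
  rw [Real.fourier_eq', Real.fourier_eq', ← integral_const_mul]
  congr 1
  ext t
  rw [← e]
  simp
  ring

open FourierTransform in
theorem exists_fourier_gammaDensity {a : ℂ} (ha : 0 < a.re) :
    ∃ c : ℂ, ∀ ξ : ℝ, (1 + 2 * Real.pi * Complex.I * ξ) ^ a * 𝓕 (gammaDensity a) ξ = c := by
  have hre : ∀ ξ : ℝ, (1 + 2 * Real.pi * Complex.I * ξ : ℂ).re = 1 := fun ξ => by simp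
  have hd : ∀ ξ : ℝ, HasDerivAt
      (fun ξ : ℝ => (1 + 2 * Real.pi * Complex.I * ξ : ℂ) ^ a * 𝓕 (gammaDensity a) ξ) 0 ξ := by
    intro ξ
    have h0 : HasDerivAt (fun t : ℝ => (t : ℂ)) 1 ξ := Complex.ofRealCLM.hasDerivAt
    have h1 := ((h0.const_mul (2 * Real.pi * Complex.I)).const_add 1)
    have hs : (1 + 2 * Real.pi * Complex.I * ξ : ℂ) ∈ Complex.slitPlane :=
      Or.inl (by rw [hre]; exact one_pos)
    have hne := Complex.slitPlane_ne_zero hs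
    have h2 : HasDerivAt (fun z : ℂ => z ^ a)
        (a * (1 + 2 * Real.pi * Complex.I * ξ) ^ (a - 1)) (1 + 2 * Real.pi * Complex.I * ξ) := by
      simpa using (hasDerivAt_id (1 + 2 * Real.pi * Complex.I * ξ : ℂ)).cpow_const hs
    have h3 := (HasDerivAt.comp ξ h2 h1).mul (hasDerivAt_fourier_gammaDensity ha ξ)
    convert! h3 using 1
    have h4 := mul_fourier_gammaDensity_add_one ha ξ
    simp only [Function.comp_apply]
    rw [Complex.cpow_sub _ _ hne, Complex.cpow_one]
    field_simp
    linear_combination 2 * Real.pi * Complex.I * (1 + 2 * Real.pi * Complex.I * ξ) ^ a * h4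
  refine ⟨_, fun ξ => is_const_of_deriv_eq_zero (fun x => (hd x).differentiableAt)
    (fun x => (hd x).deriv) ξ 0⟩

theorem norm_cpow_mul_inv_pow_le {b : ℂ} (hb : 0 ≤ b.re) (n : ℕ) {t : ℝ} (ht : 0 < t)
    (ht1 : t ≤ 1) : ‖(t : ℂ) ^ b * ((1 + (t : ℂ)) ^ n)⁻¹‖ ≤ 1 := by
  have h1 : ‖(1 + (t : ℂ))‖ = 1 + t := by
    rw [← Complex.ofReal_one, ← Complex.ofReal_add, Complex.norm_real,
      Real.norm_of_nonneg (by linarith)]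
  rw [norm_mul, Complex.norm_cpow_eq_rpow_re_of_pos ht, norm_inv, norm_pow, h1]
  exact mul_le_one₀ (Real.rpow_le_one ht.le ht1 hb) (by positivity)
    (inv_le_one_of_one_le₀ (one_le_pow₀ (by linarith)))

theorem measurable_cpow_mul_inv_pow (b : ℂ) (n : ℕ) :
    Measurable (fun t : ℝ => (t : ℂ) ^ b * ((1 + (t : ℂ)) ^ n)⁻¹) := by
  fun_prop

theorem intervalIntegrable_cpow_mul_inv_pow {b : ℂ} (hb : 0 ≤ b.re) (n : ℕ) :
    IntervalIntegrable (fun t : ℝ => (t : ℂ) ^ b * ((1 + (t : ℂ)) ^ n)⁻¹) volume 0 1 := by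
  rw [intervalIntegrable_iff_integrableOn_Ioc_of_le zero_le_one]
  refine Measure.integrableOn_of_bounded (M := 1) (by simp)
    (measurable_cpow_mul_inv_pow b n).aestronglyMeasurable ?_
  filter_upwards [ae_restrict_mem measurableSet_Ioc] with t ht
  exact norm_cpow_mul_inv_pow_le hb n ht.1 ht.2

theorem norm_integral_cpow_mul_inv_pow_le {b : ℂ} (hb : 0 ≤ b.re) (n : ℕ) :
    ‖∫ t in (0 : ℝ)..1, (t : ℂ) ^ b * ((1 + (t : ℂ)) ^ n)⁻¹‖ ≤ 1 := by
  have := intervalIntegral.norm_integral_le_of_norm_le_const (a := (0 : ℝ)) (b := 1) (C := 1)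
    (f := fun t : ℝ => (t : ℂ) ^ b * ((1 + (t : ℂ)) ^ n)⁻¹) (fun t ht => by
      rw [Set.uIoc_of_le zero_le_one] at ht
      exact norm_cpow_mul_inv_pow_le hb n ht.1 ht.2)
  simpa using this

theorem integral_cpow_mul_inv_pow_recurrence {b : ℂ} (hb : 0 ≤ b.re) (m : ℕ) :
    (b + 1) * ∫ t in (0 : ℝ)..1, (t : ℂ) ^ b * ((1 + (t : ℂ)) ^ (m + 1))⁻¹ =
      (2 ^ (m + 1))⁻¹ +
        (m + 1) * ∫ t in (0 : ℝ)..1, (t : ℂ) ^ (b + 1) * ((1 + (t : ℂ)) ^ (m + 2))⁻¹ := by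
  have hb1 : 0 < (b + 1).re := by simp; linarith
  have hb0 : b + 1 ≠ 0 := by intro h; rw [h] at hb1; simp at hb1
  have hpos : ∀ t : ℝ, 0 ≤ t → (1 + (t : ℂ)) ≠ 0 := by
    intro t ht
    have : (1 + t : ℝ) ≠ 0 := by linarith
    exact_mod_cast this
  have i1 := (intervalIntegrable_cpow_mul_inv_pow hb (m + 1)).const_mul (b + 1)
  have i2 := (intervalIntegrable_cpow_mul_inv_pow hb1.le (m + 2)).const_mul (m + 1)
  have h := intervalIntegral.integral_eq_sub_of_hasDerivAt_of_le (a := (0 : ℝ)) (b := 1)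
    (f := fun t : ℝ => (t : ℂ) ^ (b + 1) * ((1 + (t : ℂ)) ^ (m + 1))⁻¹)
    (f' := fun t : ℝ => (b + 1) * ((t : ℂ) ^ b * ((1 + (t : ℂ)) ^ (m + 1))⁻¹) -
      (m + 1) * ((t : ℂ) ^ (b + 1) * ((1 + (t : ℂ)) ^ (m + 2))⁻¹)) zero_le_one ?_ ?_ (i1.sub i2)
  · rw [intervalIntegral.integral_sub i1 i2, intervalIntegral.integral_const_mul,
      intervalIntegral.integral_const_mul] at h
    simp only [Complex.ofReal_one, Complex.one_cpow, Complex.ofReal_zero,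
      Complex.zero_cpow hb0] at h
    norm_num at h
    rw [← one_add_one_eq_two]
    norm_num
    linear_combination h
  · intro t ht
    refine ContinuousAt.continuousWithinAt (ContinuousAt.mul
      (Complex.continuousAt_ofReal_cpow_const t _ (Or.inl hb1)) (ContinuousAt.inv₀ (by fun_prop) ?_))
    exact pow_ne_zero _ (hpos t ht.1)
  · intro t ht
    have h0 : HasDerivAt (fun t : ℝ => (t : ℂ)) 1 t := Complex.ofRealCLM.hasDerivAt
    have h1 := hasDerivAt_ofReal_cpow_const (x := t) ht.1.ne' hb0
    have hne := hpos t ht.1.le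
    have h2 := ((h0.const_add 1).pow (m + 1)).inv (pow_ne_zero _ hne)
    convert! h1.mul h2 using 1
    simp only [add_sub_cancel_right, Pi.pow_apply, Pi.inv_apply]
    push_cast
    field_simp
    ring

theorem norm_integral_cpow_ge :
    1 / 600 ≤ ‖∫ t in (0 : ℝ)..1, (t : ℂ) ^ (100 * Complex.I) * ((1 + (t : ℂ)) ^ 2)⁻¹‖ := by
  have e1 := integral_cpow_mul_inv_pow_recurrence (b := 100 * Complex.I) (by simp) 1
  have e2 := integral_cpow_mul_inv_pow_recurrence (b := 100 * Complex.I + 1) (by simp) 2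
  have e3 := norm_integral_cpow_mul_inv_pow_le (b := 100 * Complex.I + 1 + 1) (by simp) 4
  norm_num at e1 e2 e3
  set J0 := ∫ t in (0 : ℝ)..1, (t : ℂ) ^ (100 * Complex.I) * ((1 + (t : ℂ)) ^ 2)⁻¹
  set J1 := ∫ t in (0 : ℝ)..1, (t : ℂ) ^ (100 * Complex.I + 1) * ((1 + (t : ℂ)) ^ 3)⁻¹
  set J2 := ∫ t in (0 : ℝ)..1, (t : ℂ) ^ (100 * Complex.I + 1 + 1) * ((1 + (t : ℂ)) ^ 4)⁻¹
  have n2 : 100 * ‖J1‖ ≤ 25 / 8 := by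
    have h1 : (100 : ℝ) ≤ ‖(100 * Complex.I + 1 + 1 : ℂ)‖ := by
      refine le_trans ?_ (Complex.abs_im_le_norm _)
      simp
    calc 100 * ‖J1‖ ≤ ‖(100 * Complex.I + 1 + 1 : ℂ)‖ * ‖J1‖ := by gcongr
      _ = ‖(8⁻¹ + 3 * J2 : ℂ)‖ := by rw [← norm_mul]; congr 1; linear_combination e2
      _ ≤ ‖(8⁻¹ : ℂ)‖ + ‖(3 * J2 : ℂ)‖ := norm_add_le _ _
      _ ≤ 8⁻¹ + 3 * 1 := by
        rw [norm_mul]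
        norm_num
        linarith
      _ = _ := by norm_num
  have h1 : ‖(100 * Complex.I + 1 : ℂ)‖ ≤ 101 := by
    refine (norm_add_le _ _).trans ?_
    simp
    norm_num
  have n1 : 1 / 4 - 2 * ‖J1‖ ≤ 101 * ‖J0‖ := by
    calc 1 / 4 - 2 * ‖J1‖ = ‖(4⁻¹ : ℂ)‖ - ‖(-(2 * J1) : ℂ)‖ := by simp
      _ ≤ ‖(4⁻¹ - -(2 * J1) : ℂ)‖ := norm_sub_norm_le _ _
      _ = ‖(100 * Complex.I + 1 : ℂ)‖ * ‖J0‖ := by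
        rw [← norm_mul]; congr 1; linear_combination -e1
      _ ≤ _ := by gcongr
  linarith

theorem norm_sq_gammaDensity (τ t : ℝ) : ‖gammaDensity (1 + τ * Complex.I) t‖ ^ 2 =
    (Set.Ioi (0 : ℝ)).indicator (fun t => Real.exp (-2 * t)) t := by
  by_cases ht : t ∈ Set.Ioi (0 : ℝ)
  · rw [gammaDensity, Set.indicator_of_mem ht, Set.indicator_of_mem ht, norm_mul,
      Complex.norm_cpow_eq_rpow_re_of_pos ht, Complex.norm_exp, mul_pow, ← Real.exp_nat_mul]
    simp
  · simp [gammaDensity, ht]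

theorem memLp_gammaDensity (τ : ℝ) : MemLp (gammaDensity (1 + τ * Complex.I)) 2 volume := by
  rw [memLp_two_iff_integrable_sq_norm (integrable_gammaDensity (by simp)).1]
  simp_rw [norm_sq_gammaDensity]
  rw [integrable_indicator_iff measurableSet_Ioi]
  exact integrableOn_exp_mul_Ioi (by norm_num) 0

theorem integral_norm_sq_gammaDensity (τ : ℝ) :
    ∫ t, ‖gammaDensity (1 + τ * Complex.I) t‖ ^ 2 = 1 / 2 := by
  simp_rw [norm_sq_gammaDensity]
  rw [integral_indicator measurableSet_Ioi, integral_exp_mul_Ioi (by norm_num)]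
  norm_num

open FourierTransform in
theorem exists_norm_sq_fourier_gammaDensity (τ : ℝ) :
    ∃ C : ℝ, 0 ≤ C ∧ ∀ ξ : ℝ, ‖𝓕 (gammaDensity (1 + τ * Complex.I)) ξ‖ ^ 2 =
      C * Real.exp (2 * τ * (1 + 2 * Real.pi * Complex.I * ξ : ℂ).arg) *
        (1 + (2 * Real.pi * ξ) ^ 2)⁻¹ := by
  obtain ⟨c, hc⟩ := exists_fourier_gammaDensity (a := 1 + τ * Complex.I) (by simp)
  refine ⟨‖c‖ ^ 2, by positivity, fun ξ => ?_⟩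
  set r : ℂ := 1 + 2 * Real.pi * Complex.I * ξ with hr
  have hn : ‖r‖ ^ 2 = 1 + (2 * Real.pi * ξ) ^ 2 := by
    rw [← Complex.normSq_eq_norm_sq, Complex.normSq_apply]
    simp [hr]
    ring
  have hne : r ≠ 0 := by
    intro h0
    rw [h0, norm_zero] at hn
    nlinarith [sq_nonneg (2 * Real.pi * ξ)]
  have hr0 := norm_pos_iff.2 hne
  rw [← hc ξ, ← hn, ← hr, norm_mul, Complex.norm_cpow_of_ne_zero hne]
  have : Real.exp (2 * τ * r.arg) = Real.exp (r.arg * τ) ^ 2 := by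
    rw [← Real.exp_nat_mul]
    congr 1
    push_cast
    ring
  rw [this]
  have := Real.exp_pos (r.arg * τ)
  simp
  field_simp

theorem half_le_arg {ξ : ℝ} (hξ : 1 ≤ ξ) :
    1 / 2 ≤ (1 + 2 * Real.pi * Complex.I * ξ : ℂ).arg := by
  have hpi := Real.pi_gt_three
  set r : ℂ := 1 + 2 * Real.pi * Complex.I * ξ with hr
  have him : r.im = 2 * Real.pi * ξ := by simp [hr]
  have h1 : 1 ≤ r.im := by rw [him]; nlinarith
  have h0 : 0 ≤ r.arg := Complex.arg_nonneg_iff.2 (by linarith)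
  refine le_trans ?_ (Real.sin_le h0)
  rw [Complex.sin_arg]
  have hn : ‖r‖ ≤ 2 * r.im := by
    refine (Complex.norm_le_abs_re_add_abs_im r).trans ?_
    rw [abs_of_pos (by linarith : 0 < r.im)]
    have : r.re = 1 := by simp [hr]
    rw [this, abs_one]
    linarith
  have hp : 0 < ‖r‖ := lt_of_lt_of_le (by linarith) (Complex.im_le_norm r)
  rw [le_div_iff₀ hp]
  linarith

open FourierTransform in
/-- For large frequencies, `gammaDensity` is almost entirely supported on positive frequencies. -/
theorem norm_sq_sub_halfLineFourier_gammaDensity_le (u : Lp ℂ 2 (volume : Measure ℝ))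
    (hu : u =ᵐ[volume] gammaDensity (1 + (100 : ℝ) * Complex.I)) :
    ‖u‖ ^ 2 - ‖halfLineFourier u‖ ^ 2 ≤ 400 * Real.exp (-100) := by
  have hpi := Real.pi_gt_three
  have hpi4 := Real.pi_lt_d2
  obtain ⟨C, hC, h⟩ := exists_norm_sq_fourier_gammaDensity 100
  obtain ⟨h1, h2, h3, h4⟩ := norm_sq_sub_inner_halfLineFourier u hu
    (integrable_gammaDensity (by simp)) (fun x hx => by
      rw [gammaDensity, Set.indicator_of_notMem (by simpa using hx.le)])
  have hu2 : ‖u‖ ^ 2 = 1 / 2 := by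
    rw [Lp.norm_sq_eq_integral, ← integral_norm_sq_gammaDensity 100]
    exact integral_congr_ae (hu.mono fun x hx => by simp only [hx])
  have hneg : ∫ ξ in Set.Iio (0 : ℝ), ‖𝓕 (gammaDensity (1 + (100 : ℝ) * Complex.I)) ξ‖ ^ 2 ≤
      C * Real.pi := by
    calc _ ≤ ∫ ξ in Set.Iio (0 : ℝ), C * (1 + ξ ^ 2)⁻¹ := by
          refine setIntegral_mono_on h1 (integrable_inv_one_add_sq.const_mul C).integrableOn
            measurableSet_Iio fun ξ hξ => ?_
          rw [h ξ]
          have harg : (1 + 2 * Real.pi * Complex.I * ξ : ℂ).arg < 0 := by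
            rw [Complex.arg_neg_iff]
            simp only [Set.mem_Iio] at hξ
            simp
            nlinarith
          have he : Real.exp (2 * 100 * (1 + 2 * Real.pi * Complex.I * ξ : ℂ).arg) ≤ 1 :=
            Real.exp_le_one_iff.2 (by linarith)
          have hinv : (1 + (2 * Real.pi * ξ) ^ 2)⁻¹ ≤ (1 + ξ ^ 2)⁻¹ := by
            apply inv_anti₀ (by positivity)
            rw [mul_pow]
            have : ξ ^ 2 ≤ (2 * Real.pi) ^ 2 * ξ ^ 2 :=
              le_mul_of_one_le_left (sq_nonneg ξ) (by nlinarith)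
            linarith
          calc _ ≤ C * 1 * (1 + ξ ^ 2)⁻¹ := by gcongr
            _ = _ := by ring
      _ ≤ ∫ ξ, C * (1 + ξ ^ 2)⁻¹ := by
          refine setIntegral_le_integral (integrable_inv_one_add_sq.const_mul C)
            (Filter.Eventually.of_forall fun ξ => ?_)
          simp only [Pi.zero_apply]
          positivity
      _ = _ := by rw [integral_const_mul, integral_univ_inv_one_add_sq]
  have hposi : C * Real.exp 100 * (1 / 200) ≤ ‖halfLineFourier u‖ ^ 2 := by
    rw [h4]
    calc C * Real.exp 100 * (1 / 200)
        = ∫ ξ in Set.Icc (1 : ℝ) 2, C * Real.exp 100 * (1 / 200) := by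
          rw [setIntegral_const]
          norm_num
      _ ≤ ∫ ξ in Set.Icc (1 : ℝ) 2, ‖𝓕 (gammaDensity (1 + (100 : ℝ) * Complex.I)) ξ‖ ^ 2 := by
          refine setIntegral_mono_on (integrableOn_const (by simp))
            (h3.mono_set fun ξ hξ => zero_le_one.trans hξ.1) measurableSet_Icc fun ξ hξ => ?_
          rw [h ξ]
          have := half_le_arg hξ.1
          gcongr
          · linarith
          · rw [one_div]
            apply inv_anti₀ (by positivity)
            have : 2 * Real.pi * ξ ≤ 13 := by nlinarith [hξ.1, hξ.2]
            have h0 : 0 ≤ 2 * Real.pi * ξ := by nlinarith [hξ.1, hξ.2]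
            nlinarith
      _ ≤ _ := by
          refine setIntegral_mono_set h3 (Filter.Eventually.of_forall fun ξ => ?_)
            (LE.le.eventuallyLE fun ξ hξ => zero_le_one.trans hξ.1)
          simp only [Pi.zero_apply]
          positivity
  have hint : 0 ≤ ∫ ξ in Set.Iio (0 : ℝ),
      ‖𝓕 (gammaDensity (1 + (100 : ℝ) * Complex.I)) ξ‖ ^ 2 :=
    integral_nonneg fun ξ => by positivity
  have hC2 : C * Real.exp 100 ≤ 100 := by linarith
  have hC3 : C ≤ 100 * Real.exp (-100) := by
    rw [Real.exp_neg, ← div_eq_mul_inv, le_div_iff₀ (Real.exp_pos _)]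
    exact hC2
  have hCpi : C * Real.pi ≤ 400 * Real.exp (-100) := by nlinarith
  linarith

theorem crossKernel_mul_gammaDensity (τ : ℝ) {x : ℝ} (hx : 0 < x) (t : ℝ) :
    x * (crossKernel (-x * t, x) * (gammaDensity (1 + τ * Complex.I) (-(-x * t)) *
      conj (gammaDensity (1 + τ * Complex.I) x))) =
    (Set.Ioc (0 : ℝ) 1).indicator (fun t : ℝ => Complex.I / (2 * Real.pi) *
      ((t : ℂ) ^ (τ * Complex.I) * (1 + (t : ℂ))⁻¹) * Complex.exp (-(1 + t) * x)) t := by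
  have ha : (1 + τ * Complex.I - 1 : ℂ) = τ * Complex.I := by ring
  rw [neg_mul, neg_neg]
  by_cases ht : t ∈ Set.Ioc (0 : ℝ) 1
  · have hxt : 0 < x * t := mul_pos hx ht.1
    have hmem : (-(x * t), x) ∈ crossRegion := by
      refine ⟨?_, Or.inl ?_⟩
      · simp only
        nlinarith [ht.2]
      · simp only
        linarith
    rw [Set.indicator_of_mem ht, crossKernel, Set.indicator_of_mem hmem, gammaDensity,
      Set.indicator_of_mem (by exact hxt), Set.indicator_of_mem (by exact hx), ha,
      Complex.ofReal_mul, Complex.mul_cpow_ofReal_nonneg hx.le ht.1.le, map_mul]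
    have h1 : (x : ℂ) ^ (τ * Complex.I) * conj ((x : ℂ) ^ (τ * Complex.I)) = 1 := by
      rw [Complex.mul_conj, Complex.normSq_eq_norm_sq, Complex.norm_cpow_eq_rpow_re_of_pos hx]
      simp
    have h2 : conj (Complex.exp (-(x : ℂ))) = Complex.exp (-x) := by
      rw [← Complex.exp_conj]
      simp
    have h3 : Complex.exp (-(1 + t) * x) = Complex.exp (-(x * t)) * Complex.exp (-x) := by
      rw [← Complex.exp_add]
      congr 1
      ring
    have hx0 : (x : ℂ) ≠ 0 := by exact_mod_cast hx.ne'
    have ht0 : (1 + (t : ℂ)) ≠ 0 := by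
      have : (1 + t : ℝ) ≠ 0 := by linarith [ht.1]
      exact_mod_cast this
    have hpi : (Real.pi : ℂ) ≠ 0 := by exact_mod_cast Real.pi_ne_zero
    have h4 : (x : ℂ) * (2 * Real.pi * Complex.I * (((-(x * t) : ℝ) : ℂ) - x))⁻¹ =
        Complex.I / (2 * Real.pi) * (1 + (t : ℂ))⁻¹ := by
      have : (2 * Real.pi * Complex.I * (((-(x * t) : ℝ) : ℂ) - x)) =
          x * (1 + t) * (2 * Real.pi) * (-Complex.I) := by
        push_cast
        ring
      rw [this, mul_inv, mul_inv, mul_inv, inv_neg, Complex.inv_I, neg_neg]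
      field_simp
    rw [h2, h3]
    calc _ = (x : ℂ) * (2 * Real.pi * Complex.I * (((-(x * t) : ℝ) : ℂ) - x))⁻¹ *
          ((x : ℂ) ^ (τ * Complex.I) * conj ((x : ℂ) ^ (τ * Complex.I))) *
          (Complex.exp (-(x * t)) * (t : ℂ) ^ (τ * Complex.I) * Complex.exp (-x)) := by ring
      _ = _ := by
        rw [h4, h1]
        ring
  · rw [Set.indicator_of_notMem ht]
    rcases le_or_gt t 0 with h0 | h0
    · have : gammaDensity (1 + τ * Complex.I) (x * t) = 0 := by
        rw [gammaDensity, Set.indicator_of_notMem]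
        simp only [Set.mem_Ioi, not_lt]
        exact mul_nonpos_of_nonneg_of_nonpos hx.le h0
      rw [this]
      simp
    · have h1 : 1 < t := by
        by_contra h1
        exact ht ⟨h0, not_lt.1 h1⟩
      have : crossKernel (-(x * t), x) = 0 := by
        rw [crossKernel, Set.indicator_of_notMem]
        rintro ⟨h2, -⟩
        simp only at h2
        nlinarith
      rw [this]
      simp

theorem integral_exp_neg_one_add_mul {t : ℝ} (ht : 0 < t) :
    ∫ x in Set.Ioi (0 : ℝ), Complex.exp (-(1 + t) * x) = (1 + (t : ℂ))⁻¹ := by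
  have h := integral_exp_mul_complex_Ioi (a := -(1 + (t : ℂ))) (by simp; linarith) 0
  rw [h, neg_div_neg_eq]
  simp

theorem integral_crossKernel_gammaDensity (τ : ℝ) :
    ∫ p : ℝ × ℝ, crossKernel p * (gammaDensity (1 + τ * Complex.I) (-p.1) *
      conj (gammaDensity (1 + τ * Complex.I) p.2)) =
    Complex.I / (2 * Real.pi) *
      ∫ t in (0 : ℝ)..1, (t : ℂ) ^ (τ * Complex.I) * ((1 + (t : ℂ)) ^ 2)⁻¹ := by
  have hmem := memLp_gammaDensity τ
  have hint := (integrable_kernel_mul measurable_crossKernel norm_crossKernel_le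
    (hmem.comp_measurePreserving (Measure.measurePreserving_neg volume)) hmem).1
  simp only [Function.comp_apply] at hint
  rw [Measure.volume_eq_prod] at hint ⊢
  rw [integral_prod_symm _ hint]
  have hinner : ∀ x : ℝ, ∫ s, crossKernel (s, x) * (gammaDensity (1 + τ * Complex.I) (-s) *
      conj (gammaDensity (1 + τ * Complex.I) x)) =
      (Set.Ioi (0 : ℝ)).indicator (fun x : ℝ => ∫ t in Set.Ioc (0 : ℝ) 1,
        Complex.I / (2 * Real.pi) * ((t : ℂ) ^ (τ * Complex.I) * (1 + (t : ℂ))⁻¹) *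
          Complex.exp (-(1 + t) * x)) x := by
    intro x
    by_cases hx : x ∈ Set.Ioi (0 : ℝ)
    · have hx0 : 0 < x := hx
      rw [Set.indicator_of_mem hx, ← integral_indicator measurableSet_Ioc]
      simp_rw [← crossKernel_mul_gammaDensity τ hx0]
      rw [integral_const_mul]
      have := Measure.integral_comp_mul_left (fun s => crossKernel (s, x) *
        (gammaDensity (1 + τ * Complex.I) (-s) * conj (gammaDensity (1 + τ * Complex.I) x))) (-x)
      rw [this, abs_inv, abs_neg, abs_of_pos hx0, Complex.real_smul, Complex.ofReal_inv,
        mul_inv_cancel_left₀ (by exact_mod_cast hx0.ne')]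
    · rw [Set.indicator_of_notMem hx]
      have : gammaDensity (1 + τ * Complex.I) x = 0 := by
        rw [gammaDensity, Set.indicator_of_notMem hx]
      simp [this]
  simp_rw [hinner]
  rw [integral_indicator measurableSet_Ioi]
  have hF : Integrable (Function.uncurry fun (x t : ℝ) =>
      Complex.I / (2 * Real.pi) * ((t : ℂ) ^ (τ * Complex.I) * (1 + (t : ℂ))⁻¹) *
          Complex.exp (-(1 + t) * x))
      ((volume.restrict (Set.Ioi (0 : ℝ))).prod (volume.restrict (Set.Ioc (0 : ℝ) 1))) := by
    have hexp : IntegrableOn (fun x : ℝ => Real.exp (-1 * x)) (Set.Ioi 0) :=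
      integrableOn_exp_mul_Ioi (by norm_num) 0
    have hone : IntegrableOn (fun _ : ℝ => (1 : ℝ)) (Set.Ioc (0 : ℝ) 1) :=
      integrableOn_const (by simp)
    refine Integrable.mono' (hexp.mul_prod hone) (Measurable.aestronglyMeasurable (by fun_prop)) ?_
    rw [Measure.prod_restrict]
    filter_upwards [ae_restrict_mem (measurableSet_Ioi.prod measurableSet_Ioc)] with q hq
    obtain ⟨hx, ht⟩ := hq
    simp only [Set.mem_Ioi] at hx
    have h1 : ‖(Complex.I / (2 * Real.pi) : ℂ)‖ ≤ 1 := by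
      have := Real.pi_gt_three
      rw [norm_div, Complex.norm_I, norm_mul, Complex.norm_real, Real.norm_of_nonneg (by linarith)]
      apply div_le_one_of_le₀ _ (by positivity)
      norm_num
      linarith
    have h2 := norm_cpow_mul_inv_pow_le (b := τ * Complex.I) (by simp) 1 ht.1 ht.2
    rw [pow_one] at h2
    have h3 : ‖Complex.exp (-(1 + q.2) * q.1)‖ ≤ Real.exp (-1 * q.1) := by
      rw [Complex.norm_exp, Real.exp_le_exp]
      simp
      nlinarith [ht.1]
    simp only [Function.uncurry]
    rw [norm_mul, norm_mul, mul_one]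
    calc _ ≤ 1 * 1 * Real.exp (-1 * q.1) := by gcongr
      _ = _ := by ring
  rw [integral_integral_swap hF, intervalIntegral.integral_of_le zero_le_one, ← integral_const_mul]
  refine setIntegral_congr_fun measurableSet_Ioc fun t ht => ?_
  rw [integral_const_mul, integral_exp_neg_one_add_mul ht.1]
  have ht0 : (1 + (t : ℂ)) ≠ 0 := by
    have : (1 + t : ℝ) ≠ 0 := by linarith [ht.1]
    exact_mod_cast this
  field_simp

section Operator

variable {E : Type*} [NormedAddCommGroup E] [InnerProductSpace ℂ E] [CompleteSpace E]

/-- The Cauchy-Schwarz inequality for the form of a nonnegative operator. -/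
theorem norm_inner_sq_le_of_nonneg {T : E →L[ℂ] E} (hT : 0 ≤ T) (u f : E) :
    ‖inner ℂ u (T f)‖ ^ 2 ≤ (inner ℂ u (T u)).re * (inner ℂ f (T f)).re := by
  obtain ⟨S, rfl⟩ := CStarAlgebra.nonneg_iff_eq_star_mul_self.1 hT
  have h : ∀ x y : E, inner ℂ x ((star S * S) y) = inner ℂ (S x) (S y) := fun x y => by
    rw [ContinuousLinearMap.star_eq_adjoint, mul_apply_eq_comp,
      ContinuousLinearMap.adjoint_inner_right]
  have h2 : ∀ x : E, (inner ℂ x ((star S * S) x)).re = ‖S x‖ ^ 2 := fun x => by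
    rw [h, ← inner_self_eq_norm_sq (𝕜 := ℂ)]
    rfl
  rw [h2, h2, h, ← mul_pow]
  gcongr
  exact norm_inner_le_norm _ _

theorem isBounded_spectrum_real (A : E →L[ℂ] E) : Bornology.IsBounded (spectrum ℝ A) := by
  refine (Metric.isBounded_closedBall (x := (0 : ℝ)) (r := ‖A‖ * ‖(1 : E →L[ℂ] E)‖)).subset
    fun x hx => ?_
  have := spectrum.norm_le_norm_mul_of_mem (spectrum.algebraMap_mem ℂ hx)
  simpa using this

theorem sInf_spectrum_neg {A : E →L[ℂ] E} (hA : IsSelfAdjoint A) {u f : E}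
    (hf : inner ℂ f (A f) = 0) (hu : inner ℂ u (A f) ≠ 0) : sInf (spectrum ℝ A) < 0 := by
  by_contra! h
  have hT : 0 ≤ A := (StarOrderedRing.nonneg_iff_spectrum_nonneg A hA).2 fun x hx =>
    h.trans (csInf_le (isBounded_spectrum_real A).bddBelow hx)
  have := norm_inner_sq_le_of_nonneg hT u f
  rw [hf, Complex.zero_re, mul_zero] at this
  have h2 := norm_pos_iff.2 hu
  nlinarith

theorem one_lt_sSup_spectrum {A : E →L[ℂ] E} (hA : IsSelfAdjoint A) {u f : E}
    (hf : inner ℂ f (A f) = 0) (huf : inner ℂ u f = 0)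
    (h : (‖u‖ ^ 2 - (inner ℂ u (A u)).re) * ‖f‖ ^ 2 < ‖inner ℂ u (A f)‖ ^ 2) :
    1 < sSup (spectrum ℝ A) := by
  by_contra! h1
  have hT : A ≤ 1 := by
    simpa using le_algebraMap_of_spectrum_le (r := (1 : ℝ)) (a := A)
      (fun x hx => (le_csSup (isBounded_spectrum_real A).bddAbove hx).trans h1) hA
  have h2 := norm_inner_sq_le_of_nonneg (sub_nonneg.2 hT) u f
  have e : ∀ x y : E, inner ℂ x ((1 - A) y) = inner ℂ x y - inner ℂ x (A y) := fun x y => by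
    rw [sub_apply, one_apply_eq_self, inner_sub_right]
  have hn : ∀ x : E, (inner ℂ x x : ℂ).re = ‖x‖ ^ 2 := fun x => by
    rw [← inner_self_eq_norm_sq (𝕜 := ℂ)]
    rfl
  rw [e, e, e, huf, hf, zero_sub, norm_neg, sub_zero, Complex.sub_re, hn, hn] at h2
  linarith

end Operator

theorem exists_test_functions : ∃ u f : Lp ℂ 2 (volume : Measure ℝ),
    inner ℂ f (quarterPlaneOperator f) = 0 ∧ inner ℂ u f = 0 ∧ ‖f‖ ^ 2 = 1 / 2 ∧
    ‖u‖ ^ 2 - (inner ℂ u (quarterPlaneOperator u)).re ≤ 400 * Real.exp (-100) ∧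
    1 / 4200 ≤ ‖inner ℂ u (quarterPlaneOperator f)‖ := by
  set G := gammaDensity (1 + (100 : ℝ) * Complex.I) with hG
  have hG0 : ∀ x ≤ 0, G x = 0 := fun x hx => by
    rw [hG, gammaDensity, Set.indicator_of_notMem (by simpa using hx)]
  have hGm : MemLp G 2 volume := memLp_gammaDensity 100
  have hGn : MemLp (fun x => G (-x)) 2 volume :=
    hGm.comp_measurePreserving (Measure.measurePreserving_neg volume)
  set u := hGm.toLp
  set f := hGn.toLp
  have hu : u =ᵐ[volume] G := hGm.coeFn_toLp
  have hf : f =ᵐ[volume] fun x => G (-x) := hGn.coeFn_toLp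
  have hTf : halfLineFourier f = 0 := by
    have : Lp.indicatorCLM (measurableSet_Ici (a := (0 : ℝ))) f = 0 := by
      rw [Lp.eq_zero_iff_ae_eq_zero]
      filter_upwards [Lp.indicatorCLM_coeFn (measurableSet_Ici (a := (0 : ℝ))) f, hf] with x h1 h2
      rw [h1]
      by_cases hx : x ∈ Set.Ici (0 : ℝ)
      · rw [Set.indicator_of_mem hx, h2, hG0 _ (by simpa using hx)]
        rfl
      · rw [Set.indicator_of_notMem hx]
        rfl
    simp [halfLineFourier, this]
  have hKff : crossForm f f = 0 := by
    rw [crossForm_congr hf hf]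
    refine integral_eq_zero_of_ae (Filter.Eventually.of_forall fun p => ?_)
    simp only [Pi.zero_apply]
    by_cases hp : p ∈ crossRegion
    · have : 0 ≤ p.1 ∨ 0 ≤ p.2 := by
        by_contra! h
        linarith [hp.1]
      rcases this with h | h
      · rw [hG0 (-p.1) (by linarith)]
        simp
      · rw [hG0 (-p.2) (by linarith)]
        simp
    · rw [crossKernel, Set.indicator_of_notMem hp, zero_mul]
  have hKuu : crossForm u u = 0 := by
    rw [crossForm_congr hu hu]
    refine integral_eq_zero_of_ae (Filter.Eventually.of_forall fun p => ?_)
    simp only [Pi.zero_apply]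
    by_cases hp : p ∈ crossRegion
    · rcases hp.2 with h | h
      · rw [hG0 p.1 h.le]
        simp
      · rw [hG0 p.2 h.le]
        simp
    · rw [crossKernel, Set.indicator_of_notMem hp, zero_mul]
  refine ⟨u, f, ?_, ?_, ?_, ?_, ?_⟩
  · rw [inner_quarterPlaneOperator, hTf, hKff, inner_zero_left, add_zero]
  · rw [L2.inner_def]
    refine integral_eq_zero_of_ae ?_
    filter_upwards [hu, hf] with x h1 h2
    rw [h1, h2]
    rcases le_total x 0 with hx | hx
    · rw [hG0 x hx]
      simp
    · rw [hG0 (-x) (by linarith)]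
      simp
  · rw [Lp.norm_sq_eq_integral, ← integral_norm_sq_gammaDensity 100,
      ← integral_neg_eq_self (fun x => ‖gammaDensity (1 + (100 : ℝ) * Complex.I) x‖ ^ 2)]
    exact integral_congr_ae (hf.mono fun x hx => by simp only [hx, hG])
  · have := norm_sq_sub_halfLineFourier_gammaDensity_le u hu
    rw [inner_quarterPlaneOperator, hKuu, add_zero]
    have h2 : (inner ℂ (halfLineFourier u) (halfLineFourier u)).re = ‖halfLineFourier u‖ ^ 2 := by
      rw [← inner_self_eq_norm_sq (𝕜 := ℂ)]
      rfl
    rw [h2]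
    exact this
  · have hpi := Real.pi_gt_three
    have hpi4 := Real.pi_lt_d2
    rw [inner_quarterPlaneOperator, hTf, inner_zero_right, zero_add, crossForm_congr hf hu,
      integral_crossKernel_gammaDensity, norm_mul, norm_div, Complex.norm_I, norm_mul,
      Complex.norm_real, Real.norm_of_nonneg (by linarith), Complex.norm_ofNat]
    calc (1 / 4200 : ℝ) = 1 / 7 * (1 / 600) := by norm_num
      _ ≤ _ := by
        gcongr
        · linarith
        · simpa using norm_integral_cpow_ge

theorem mainTheorem1 :
    ∃ A : Lp ℂ 2 (volume : Measure ℝ) →L[ℂ] Lp ℂ 2 (volume : Measure ℝ),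
      IsWeylQuantization quarterPlaneSymbol A ∧
      (∀ B : Lp ℂ 2 (volume : Measure ℝ) →L[ℂ] Lp ℂ 2 (volume : Measure ℝ),
        IsWeylQuantization quarterPlaneSymbol B → B = A) ∧
      IsSelfAdjoint A ∧
      sInf (spectrum ℝ A) < 0 ∧ 1 < sSup (spectrum ℝ A) := by
  obtain ⟨u, f, hff, huf, hf, hu, hc⟩ := exists_test_functions
  refine ⟨quarterPlaneOperator, isWeylQuantization_quarterPlaneOperator,
    fun B hB => isWeylQuantization_quarterPlaneOperator.unique hB,
    isSelfAdjoint_quarterPlaneOperator, ?_, ?_⟩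
  · refine sInf_spectrum_neg isSelfAdjoint_quarterPlaneOperator hff (u := u) fun h => ?_
    rw [h, norm_zero] at hc
    norm_num at hc
  · refine one_lt_sSup_spectrum isSelfAdjoint_quarterPlaneOperator hff huf ?_
    have hexp : Real.exp (-100) ≤ (1 / 2) ^ 100 := by
      have h1 : (2 : ℝ) ≤ Real.exp 1 := by linarith [Real.add_one_le_exp (1 : ℝ)]
      rw [Real.exp_neg, one_div, inv_pow]
      apply inv_anti₀ (by positivity)
      calc (2 : ℝ) ^ 100 ≤ Real.exp 1 ^ 100 := by gcongr
        _ = Real.exp 100 := by rw [← Real.exp_nat_mul]; norm_num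
    rw [hf]
    calc _ ≤ 400 * (1 / 2) ^ 100 * (1 / 2 : ℝ) := by
          gcongr
          exact hu.trans (by gcongr)
      _ < (1 / 4200) ^ 2 := by norm_num
      _ ≤ _ := by gcongr
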